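/- Let $R$ be a commutative ring with unit. Let $N\colon \mathsf{smod}_R\rightleftarrows \mathsf{Ch}^R_{\ge 0}\colon \Gamma$ be the Dold–Kan equivalence between simplicial $R$-modules and non-negatively graded chain complexes of $R$-modules, where $N_n(X)=\bigcap_{k=1}^n\ker(d_k\colon X_n\to X_{n-1})$ with differential $d_0$. Let $\hat\otimes$ be the degreewise tensor product of simplicial $R$-modules, with unit the constant simplicial module $\underline R$ and twist $\hat\tau(a\otimes b)=b\otimes a$. Transporting this symmetric monoidal structure along the equivalence makes $\mathsf{Ch}^R_{\ge 0}$ symmetric monoidal with respect to the large tensor product $C\,\tilde\otimes\, C'=N(\Gamma C\,\hat\otimes\,\Gamma C')$, with unit $N(\underline R)$ and twist $N(\hat\tau)$. Let $\mathrm{Com}_{\tilde\otimes}$ be the category of commutative monoids in this symmetric monoidal category. For $C\in \mathrm{Com}_{\tilde\otimes}$ with multiplication $\tilde\mu\colon C\tilde\otimes C\to C$, the simplicial module $\Gamma C$ is a simplicial commutative $R$-algebra with multiplication $\hat\mu\colon \Gamma C\,\hat\otimes\,\Gamma C\to\Gamma C$ determined by $N(\hat\mu)=\varphi_C^{-1}\circ\tilde\mu$,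 where $\varphi_C\colon N\Gamma C\cong C$ is the canonical isomorphism. A *divided power chain algebra* over $R$ is a non-negatively graded, unital, associative, graded commutative differential graded $R$-algebra $K_*$ together with maps $\gamma_i\colon K_n\to K_{ni}$ for all $i\ge 0$, $n>0$, such that for all homogeneous elements $a,b$ of positive degree 1. $\gamma_0(a)=1$ and $\gamma_1(a)=a$; 2. $\gamma_i(a)=0$ if $a$ has odd degree and $i>1$; 3. $\gamma_i(\lambda a)=\lambda^i\gamma_i(a)$ for $\lambda\in R$, and more generally for $\lambda\in K_0$; 4. $\gamma_i(a)\gamma_j(a)=\binom{i+j}{i}\gamma_{i+j}(a)$; 5. $\gamma_i(a+b)=\sum_{k+\ell=i}\gamma_k(a)\gamma_\ell(b)$ if $a,b$ have the same even degree; 6. $\gamma_i(ab)=i!\,\gamma_i(a)\gamma_i(b)=a^i\gamma_i(b)=\gamma_i(a)b^i$; 7. $\gamma_i(\gamma_j(a))=\frac{(ij)!}{i!\,(j!)^i}\gamma_{ij}(a)$ for $j\ge 1$; 8. $d(\gamma_i(a))=d(a)\cdot\gamma_{i-1}(a)$ for $i\ge 1$ if $a$ has even degree; 9. if $a$ is a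 boundary, then $\gamma_i(a)$ is a boundary for all $i\ge 1$. A morphism of divided power chain algebras is a unital multiplicative chain map $f$ with $f(\gamma_i(a))=\gamma_i(f(a))$ for all $i\ge 0$ and all homogeneous $a$ of positive degree. **Theorem.** The composite $N\Gamma$ is a functor from $\mathrm{Com}_{\tilde\otimes}$ to the category of divided power chain algebras. More precisely, for $C\in \mathrm{Com}_{\tilde\otimes}$ the chain complex $N\Gamma C$ is a divided power chain algebra with the unit of $\Gamma C$ in degree $0$, with the product $$N\Gamma C\otimes N\Gamma C\xrightarrow{\ \mathrm{sh}\ }N(\Gamma C\,\hat\otimes\,\Gamma C)\xrightarrow{\ N(\hat\mu)\ }N\Gamma C,$$ where $\mathrm{sh}$ is the shuffle map, and with divided powers given on elements $c\in N\Gamma(C)_n$ of even degree $n>0$ by $$\gamma_i(c)=\sum_{\sigma\in \mathrm{Sh}(n,\dots,n)/\Sigma_i}\varepsilon(\sigma)\,s_{\sigma([ni-1]\setminus\underline 1)}(c)\cdots s_{\sigma([ni-1]\setminus\underline i)}(c).$$ Here $\mathrm{Sh}(n,\dots,n)$ is the set of permutations of $[ni-1]=\{0,\dots,ni-1\}$ that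 are increasing on each of the $i$ consecutive blocks $\underline 1,\dots,\underline i$ of length $n$; the group $\Sigma_i$ acts on it by permuting the blocks; the sum is over any system of representatives of the cosets; $\varepsilon$ is the sign; $s_{\sigma([ni-1]\setminus\underline j)}$ is the composite of the degeneracies $s_{\sigma(k)}$, $k\in[ni-1]\setminus\underline j$, smaller indices being applied first; and the product is taken in $(\Gamma C)_{ni}$. In particular this sum lies in $N\Gamma(C)_{ni}$ and does not depend on the representatives. Every morphism $f$ in $\mathrm{Com}_{\tilde\otimes}$ induces a morphism $N\Gamma(f)$ of divided power chain algebras, compatibly with identities and composition. -/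

import Mathlib

open CategoryTheory MonoidalCategory Opposite
open scoped Simplicial TensorProduct Nat

universe u

namespace LargeTensor

/-! ## Differential graded commutative algebras and divided power chain algebras -/

section ChainAlgebras

variable (R : Type u) [CommRing R]

/-- The structure of a (unital, associative, graded commutative) differential graded `R`-algebra
on a non-negatively graded chain complex of `R`-modules. The product `K_p × K_q → K_r` is indexed
by a proof of `p + q = r`, so that no transport along equalities of degrees is needed. -/
structure DGCommAlgStruct (K : ChainComplex (ModuleCat.{u} R) ℕ) where
  one : K.X 0
  mul : ∀ {p q r : ℕ}, p + q = r → (K.X p →ₗ[R] K.X q →ₗ[R] K.X r)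
  one_mul : ∀ {q : ℕ} (b : K.X q), mul (Nat.zero_add q) one b = b
  mul_one : ∀ {p : ℕ} (a : K.X p), mul (Nat.add_zero p) a one = a
  mul_assoc : ∀ {p q r s t m : ℕ} (hs : p + q = s) (ht : q + r = t) (h : s + r = m)
    (h' : p + t = m) (a : K.X p) (b : K.X q) (c : K.X r),
    mul h (mul hs a b) c = mul h' a (mul ht b c)
  mul_comm : ∀ {p q r : ℕ} (h : p + q = r) (h' : q + p = r) (a : K.X p) (b : K.X q),
    mul h a b = (-1 : ℤ) ^ (p * q) • mul h' b a
  /-- The Leibniz rule for two elements of positive degree. -/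
  leibniz : ∀ {p q r : ℕ} (h : (p + 1) + (q + 1) = r + 1) (h₁ : p + (q + 1) = r)
    (h₂ : (p + 1) + q = r) (a : K.X (p + 1)) (b : K.X (q + 1)),
    K.d (r + 1) r (mul h a b) =
      mul h₁ (K.d (p + 1) p a) b + (-1 : ℤ) ^ (p + 1) • mul h₂ a (K.d (q + 1) q b)
  /-- The Leibniz rule when the second factor has degree zero (and so has zero boundary). -/
  leibniz_zero_right : ∀ {p : ℕ} (a : K.X (p + 1)) (b : K.X 0),
    K.d (p + 1) p (mul (Nat.add_zero (p + 1)) a b) =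
      mul (Nat.add_zero p) (K.d (p + 1) p a) b
  /-- The Leibniz rule when the first factor has degree zero (and so has zero boundary). -/
  leibniz_zero_left : ∀ {q : ℕ} (a : K.X 0) (b : K.X (q + 1)),
    K.d (q + 1) q (mul (Nat.zero_add (q + 1)) a b) =
      mul (Nat.zero_add q) a (K.d (q + 1) q b)

variable {R}

/-- The `i`-th power `a ^ i`, of degree `n * i`, of an element `a` of degree `n`. -/
def DGCommAlgStruct.pow {K : ChainComplex (ModuleCat.{u} R) ℕ} (S : DGCommAlgStruct R K)
    {n : ℕ} (a : K.X n) (i : ℕ) : K.X (n * i) :=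
  match i with
  | 0 => S.one
  | i + 1 => S.mul (Nat.mul_succ n i).symm (S.pow a i) a

variable (R)

/-- A differential graded commutative algebra with a compatible system of divided powers `γ_i`,
`i ≥ 0`, on the homogeneous elements of positive degree. As usual, genuine divided powers live in
even degrees: in odd degrees `γ_0 = 1`, `γ_1 = id` and `γ_i = 0` for `i > 1`. -/
structure DPChainAlgStruct (K : ChainComplex (ModuleCat.{u} R) ℕ) extends DGCommAlgStruct R K where
  /-- `gamma i` sends degree `n > 0` to degree `n * i`. -/
  gamma : ∀ (i : ℕ) {n : ℕ}, 0 < n → K.X n → K.X (n * i)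
  gamma_zero : ∀ {n : ℕ} (hn : 0 < n) (a : K.X n), gamma 0 hn a = one
  gamma_one : ∀ {n : ℕ} (hn : 0 < n) (a : K.X n),
    gamma 1 hn a = (K.XIsoOfEq (Nat.mul_one n).symm).hom a
  gamma_odd : ∀ {i n : ℕ} (hn : 0 < n) (a : K.X n), Odd n → 1 < i → gamma i hn a = 0
  gamma_smul : ∀ (i : ℕ) {n : ℕ} (hn : 0 < n) (r : R) (a : K.X n),
    gamma i hn (r • a) = r ^ i • gamma i hn a
  /-- Homogeneity with respect to elements `z` of degree zero. -/
  gamma_deg_zero_mul : ∀ (i : ℕ) {n : ℕ} (hn : 0 < n) (z : K.X 0) (a : K.X n),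
    gamma i hn (mul (Nat.zero_add n) z a) =
      mul (show 0 * i + n * i = n * i by simp) (toDGCommAlgStruct.pow z i) (gamma i hn a)
  gamma_mul_gamma : ∀ (i j : ℕ) {n : ℕ} (hn : 0 < n) (a : K.X n),
    mul (Nat.mul_add n i j).symm (gamma i hn a) (gamma j hn a) =
      (i + j).choose i • gamma (i + j) hn a
  gamma_add : ∀ (i : ℕ) {n : ℕ} (hn : 0 < n), Even n → ∀ a b : K.X n,
    gamma i hn (a + b) =
      ∑ k : Finset.HasAntidiagonal.antidiagonal i,
        mul (show n * k.1.1 + n * k.1.2 = n * i by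
            rw [← Nat.mul_add, Finset.HasAntidiagonal.mem_antidiagonal.1 k.2])
          (gamma k.1.1 hn a) (gamma k.1.2 hn b)
  gamma_mul_eq_factorial : ∀ (i : ℕ) {p q : ℕ} (hp : 0 < p) (hq : 0 < q) (a : K.X p) (b : K.X q),
    gamma i (Nat.add_pos_left hp q) (mul rfl a b) =
      i ! • mul (Nat.add_mul p q i).symm (gamma i hp a) (gamma i hq b)
  gamma_mul_eq_left : ∀ (i : ℕ) {p q : ℕ} (hp : 0 < p) (hq : 0 < q) (a : K.X p) (b : K.X q),
    gamma i (Nat.add_pos_left hp q) (mul rfl a b) =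
      mul (Nat.add_mul p q i).symm (toDGCommAlgStruct.pow a i) (gamma i hq b)
  gamma_mul_eq_right : ∀ (i : ℕ) {p q : ℕ} (hp : 0 < p) (_hq : 0 < q) (a : K.X p) (b : K.X q),
    gamma i (Nat.add_pos_left hp q) (mul rfl a b) =
      mul (Nat.add_mul p q i).symm (gamma i hp a) (toDGCommAlgStruct.pow b i)
  /-- The division of natural numbers is exact because `j > 0`. -/
  gamma_gamma : ∀ (i : ℕ) {j n : ℕ} (hn : 0 < n) (hj : 0 < j) (a : K.X n),
    gamma i (Nat.mul_pos hn hj) (gamma j hn a) =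
      ((i * j) ! / (i ! * (j !) ^ i)) •
        (K.XIsoOfEq (show n * (i * j) = n * j * i by ring)).hom (gamma (i * j) hn a)
  /-- `d (γ_{i+1} c) = d c · γ_i c` for `c` of even positive degree `n + 1`. -/
  d_gamma : ∀ (i : ℕ) {n : ℕ}, Even (n + 1) → ∀ c : K.X (n + 1),
    K.d ((n + 1) * (i + 1)) (n + (n + 1) * i) (gamma (i + 1) n.succ_pos c) =
      mul rfl (K.d (n + 1) n c) (gamma i n.succ_pos c)
  /-- The divided powers of a boundary are boundaries. -/
  gamma_boundary : ∀ {i n : ℕ} (hn : 0 < n), 1 ≤ i → ∀ b : K.X (n + 1),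
    ∃ b' : K.X (n * i + 1), K.d (n * i + 1) (n * i) b' = gamma i hn (K.d (n + 1) n b)

/-- Divided power chain algebras over `R`. -/
structure DPChainAlg where
  K : ChainComplex (ModuleCat.{u} R) ℕ
  str : DPChainAlgStruct R K

namespace DPChainAlg

variable {R}

/-- Morphisms of divided power chain algebras: unital multiplicative chain maps that commute with
the divided power operations. -/
@[ext]
structure Hom (A B : DPChainAlg R) where
  toChainMap : A.K ⟶ B.K
  map_one : toChainMap.f 0 A.str.one = B.str.one
  map_mul : ∀ {p q r : ℕ} (h : p + q = r) (a : A.K.X p) (b : A.K.X q),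
    toChainMap.f r (A.str.mul h a b) = B.str.mul h (toChainMap.f p a) (toChainMap.f q b)
  map_gamma : ∀ (i : ℕ) {n : ℕ} (hn : 0 < n) (a : A.K.X n),
    toChainMap.f (n * i) (A.str.gamma i hn a) = B.str.gamma i hn (toChainMap.f n a)

instance : Category (DPChainAlg R) where
  Hom := Hom
  id A := { toChainMap := 𝟙 A.K, map_one := rfl, map_mul := by intros; rfl,
            map_gamma := by intros; rfl }
  comp f g :=
    { toChainMap := f.toChainMap ≫ g.toChainMap
      map_one := by simp [f.map_one, g.map_one]
      map_mul := by intros; simp [f.map_mul, g.map_mul]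
      map_gamma := by intros; simp [f.map_gamma, g.map_gamma] }

/-- The underlying chain complex of a divided power chain algebra. -/
def forget : DPChainAlg R ⥤ ChainComplex (ModuleCat.{u} R) ℕ where
  obj A := A.K
  map f := Hom.toChainMap f

end DPChainAlg

end ChainAlgebras

/-! ## The large tensor product and its commutative monoids -/

noncomputable section

variable (R : Type u) [CommRing R]

/-- The Dold–Kan equivalence. Its functor is the normalization
`N_n X = ⋂_{i = 1}^n ker d_i` with differential `d_0`; its inverse is `Γ`. The isomorphisms
`NΓC ≅ C` and `ΓNA ≅ A` are its counit and the inverse of its unit. -/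
abbrev doldKan : SimplicialObject (ModuleCat.{u} R) ≌ ChainComplex (ModuleCat.{u} R) ℕ :=
  Abelian.DoldKan.equivalence

/-- The category of non-negatively graded chain complexes with the symmetric monoidal structure
transported along the Dold–Kan equivalence from the degreewise tensor product of simplicial
modules. -/
abbrev ChTilde : Type (u + 1) := Monoidal.Transported (doldKan R)

/-- The tensor product in `ChTilde R` is the large tensor product `N(ΓC ⊗ ΓC')`. -/
theorem tensorObj_eq (C C' : ChTilde R) :
    C ⊗ C' = (doldKan R).functor.obj ((doldKan R).inverse.obj C ⊗ (doldKan R).inverse.obj C') :=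
  rfl

/-- The twist of `ChTilde R` is the normalization of the twist of simplicial modules. -/
theorem braiding_eq (C C' : ChTilde R) :
    (β_ C C').hom =
      (doldKan R).functor.map
        (β_ ((doldKan R).inverse.obj C) ((doldKan R).inverse.obj C')).hom :=
  rfl

/-- The category of commutative monoids for the large tensor product. -/
abbrev ComTilde : Type (u + 1) := CommMon (ChTilde R)

/-- The functor `Γ` from `ComTilde R` to simplicial modules. -/
def Gam : ComTilde R ⥤ SimplicialObject (ModuleCat.{u} R) :=
  CommMon.forget (ChTilde R) ⋙ (Monoidal.equivalenceTransported (doldKan R)).inverse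

/-- The composite `NΓ`, as a functor from `ComTilde R` to chain complexes. -/
def NGam : ComTilde R ⥤ ChainComplex (ModuleCat.{u} R) ℕ :=
  Gam R ⋙ (doldKan R).functor

variable {R}

/-- The multiplication on the simplicial module `ΓC` of a commutative monoid `C` for the large
tensor product, `ΓC ⊗ ΓC ≅ ΓN(ΓC ⊗ ΓC) → ΓC`. -/
def muHat (C : ComTilde R) : (Gam R).obj C ⊗ (Gam R).obj C ⟶ (Gam R).obj C :=
  (doldKan R).unit.app ((Gam R).obj C ⊗ (Gam R).obj C) ≫
    (doldKan R).inverse.map (MonObj.mul (X := C.X))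

/-- The unit of the multiplication on `ΓC`, from the constant simplicial module with value `R`. -/
def etaHat (C : ComTilde R) : 𝟙_ (SimplicialObject (ModuleCat.{u} R)) ⟶ (Gam R).obj C :=
  (doldKan R).unit.app _ ≫ (doldKan R).inverse.map (MonObj.one (X := C.X))

/-- `muHat C` is the morphism whose normalization is the multiplication of `C`, up to the
canonical isomorphism `C ≅ NΓC`. -/
theorem map_muHat (C : ComTilde R) :
    (doldKan R).functor.map (muHat C) =
      MonObj.mul (X := C.X) ≫ (doldKan R).counitInv.app C.X := by
  exact (((doldKan R).functor.map_comp _ _).trans (congrArg (· ≫ _)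
    ((doldKan R).counitInv_app_functor ((Gam R).obj C ⊗ (Gam R).obj C)).symm)).trans
    ((doldKan R).counitInv.naturality (MonObj.mul (X := C.X))).symm

/-- The product of two `n`-simplices of `ΓC`. -/
def mulHat (C : ComTilde R) {n : ℕ} (x y : (Gam R).obj C _⦋n⦌) : (Gam R).obj C _⦋n⦌ :=
  (muHat C).app (op ⦋n⦌) (x ⊗ₜ[R] y)

/-- The unit `n`-simplex of `ΓC`. -/
def oneHat (C : ComTilde R) (n : ℕ) : (Gam R).obj C _⦋n⦌ :=
  (etaHat C).app (op ⦋n⦌) (1 : R)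

/-- The product `x 0 * (x 1 * (⋯ * x (i - 1)))` of a finite family of `n`-simplices of `ΓC`. -/
def prodHat (C : ComTilde R) {n i : ℕ} (x : Fin i → (Gam R).obj C _⦋n⦌) : (Gam R).obj C _⦋n⦌ :=
  (List.ofFn x).foldr (mulHat C) (oneHat C n)

/-- The inclusion of the `n`-chains of `NΓC` into the `n`-simplices of `ΓC`. -/
def incl (C : ComTilde R) (n : ℕ) : ((NGam R).obj C).X n ⟶ (Gam R).obj C _⦋n⦌ :=
  (AlgebraicTopology.NormalizedMooreComplex.objX ((Gam R).obj C) n).arrow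

end

/-! ## Shuffles -/

/-- For a family `f` of `n` pairwise different elements of `{0, …, m - 1}`, the monotone surjection
`[m] → [n]` that sends `x` to the number of values of `f` below `x`. It increases between `k` and
`k + 1` precisely when `k` is a value of `f`, hence it induces on simplicial objects the composite
of the degeneracies `s_k`, where `k` runs through the elements of `{0, …, m - 1}` that are not
values of `f`, the small indices being applied first. -/
def degen {m n : ℕ} (f : Fin n → Fin m) : ⦋m⦌ ⟶ ⦋n⦌ :=
  SimplexCategory.mkHom
    { toFun := fun x => ⟨(Finset.univ.filter fun a => (f a : ℕ) < (x : ℕ)).card,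
        Nat.lt_succ_of_le ((Finset.card_le_univ _).trans_eq (Fintype.card_fin n))⟩
      monotone' := fun x y hxy => Finset.card_le_card fun a ha => by
        simp only [Finset.mem_filter, Finset.mem_univ, true_and] at ha ⊢
        exact lt_of_lt_of_le ha hxy }

/-- `(p, q)`-shuffles: permutations of `{0, …, p + q - 1}` that are increasing on the first `p` and
on the last `q` elements. -/
def IsShuffle (p q : ℕ) (σ : Equiv.Perm (Fin (p + q))) : Prop :=
  StrictMono (fun a : Fin p => σ (Fin.castAdd q a)) ∧
    StrictMono (fun b : Fin q => σ (Fin.natAdd p b))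

noncomputable instance (p q : ℕ) : DecidablePred (IsShuffle p q) := fun _ => Classical.propDecidable _

/-- The element at place `a` of the `j`-th of the `i` consecutive blocks of length `n` of
`{0, …, n * i - 1}`, that is, `n * j + a`. -/
def blockEquiv (n i : ℕ) : Fin i × Fin n ≃ Fin (n * i) :=
  finProdFinEquiv.trans (finCongr (Nat.mul_comm i n))

/-- The set `Sh(n, …, n)` of permutations of `{0, …, n * i - 1}` that are increasing on each of the
`i` blocks of length `n`. -/
def Sh (n i : ℕ) : Set (Equiv.Perm (Fin (n * i))) :=
  {σ | ∀ j : Fin i, StrictMono fun a : Fin n => σ (blockEquiv n i (j, a))}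

/-- The permutation of the `i` blocks of length `n` induced by a permutation of `i` letters. -/
def blockPerm (n : ℕ) {i : ℕ} (ξ : Equiv.Perm (Fin i)) : Equiv.Perm (Fin (n * i)) :=
  (blockEquiv n i).permCongr (ξ.prodCongr (Equiv.refl (Fin n)))

/-- `T` is a system of representatives of `Sh(n, …, n)` modulo the permutations of the blocks. -/
def IsRepSystem (n i : ℕ) (T : Finset (Equiv.Perm (Fin (n * i)))) : Prop :=
  (∀ σ ∈ T, σ ∈ Sh n i) ∧
    ∀ σ ∈ Sh n i, ∃! τ, τ ∈ T ∧ ∃ ξ : Equiv.Perm (Fin i), τ = σ * blockPerm n ξ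

theorem blockPerm_mul (n : ℕ) {i : ℕ} (ξ ζ : Equiv.Perm (Fin i)) :
    blockPerm n (ξ * ζ) = blockPerm n ξ * blockPerm n ζ := by
  ext x
  simp [blockPerm, Equiv.permCongr_apply, Prod.map]

theorem mul_blockPerm_mem_Sh {n i : ℕ} {σ : Equiv.Perm (Fin (n * i))} (hσ : σ ∈ Sh n i)
    (ξ : Equiv.Perm (Fin i)) : σ * blockPerm n ξ ∈ Sh n i := by
  intro j
  simpa [blockPerm, Equiv.permCongr_apply] using hσ (ξ j)

/-- Systems of representatives exist. -/
theorem exists_isRepSystem (n i : ℕ) : ∃ T, IsRepSystem n i T := by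
  classical
  let s : Setoid (Equiv.Perm (Fin (n * i))) :=
    { r := fun σ τ => ∃ ξ : Equiv.Perm (Fin i), τ = σ * blockPerm n ξ
      iseqv :=
        { refl := fun σ => ⟨1, by ext x; simp [blockPerm, Equiv.permCongr_apply]⟩
          symm := by
            rintro σ _ ⟨ξ, rfl⟩
            refine ⟨ξ⁻¹, ?_⟩
            rw [mul_assoc, ← blockPerm_mul, mul_inv_cancel]
            ext x; simp [blockPerm, Equiv.permCongr_apply]
          trans := by
            rintro σ _ _ ⟨ξ, rfl⟩ ⟨ζ, rfl⟩
            exact ⟨ξ * ζ, by rw [blockPerm_mul, mul_assoc]⟩ } }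
  refine ⟨Finset.univ.filter fun σ => σ ∈ Sh n i ∧ (Quotient.mk s σ).out = σ, ?_, ?_⟩
  · intro σ hσ
    exact (Finset.mem_filter.1 hσ).2.1
  · intro σ hσ
    obtain ⟨ξ, hξ⟩ : s.r σ (Quotient.mk s σ).out := s.symm' (Quotient.mk_out σ)
    refine ⟨(Quotient.mk s σ).out, ⟨?_, ξ, hξ⟩, ?_⟩
    · simp only [Finset.mem_filter, Finset.mem_univ, true_and, Quotient.out_eq, and_true]
      rw [hξ]
      exact mul_blockPerm_mem_Sh hσ ξ
    · rintro τ ⟨hτ, hr⟩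
      have h1 : Quotient.mk s σ = Quotient.mk s τ := Quotient.sound hr
      rw [h1]
      exact (Finset.mem_filter.1 hτ).2.2.symm

noncomputable section

variable {R : Type u} [CommRing R]

/-- The action of `degen f` on the simplices of `ΓC`. -/
def degHat (C : ComTilde R) {m n : ℕ} (f : Fin n → Fin m) (x : (Gam R).obj C _⦋n⦌) :
    (Gam R).obj C _⦋m⦌ :=
  ((Gam R).obj C).map (degen f).op x

/-- The shuffle product of `a ∈ NΓ(C)_p` and `b ∈ NΓ(C)_q`, as a `(p + q)`-simplex of `ΓC`. -/
def shuffleProd (C : ComTilde R) {p q : ℕ} (a : ((NGam R).obj C).X p)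
    (b : ((NGam R).obj C).X q) : (Gam R).obj C _⦋p + q⦌ :=
  ∑ σ : Equiv.Perm (Fin (p + q)) with IsShuffle p q σ,
    (Equiv.Perm.sign σ : ℤ) •
      mulHat C (degHat C (fun k : Fin p => σ (Fin.castAdd q k)) (incl C p a))
        (degHat C (fun k : Fin q => σ (Fin.natAdd p k)) (incl C q b))

/-- The shuffle-coset expression for the `i`-th divided power of `c ∈ NΓ(C)_n`, as an
`(n * i)`-simplex of `ΓC`, formed with a given finite set `T` of shuffles. -/
def shuffleCosetSum (C : ComTilde R) {n : ℕ} (i : ℕ) (T : Finset (Equiv.Perm (Fin (n * i))))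
    (c : ((NGam R).obj C).X n) : (Gam R).obj C _⦋n * i⦌ :=
  ∑ σ ∈ T, (Equiv.Perm.sign σ : ℤ) •
    prodHat C fun j : Fin i => degHat C (fun a : Fin n => σ (blockEquiv n i (j, a))) (incl C n c)

end

end LargeTensor

/-! Let `A` be a simplicial commutative algebra and `a` an `n`-simplex. The degeneracies of `a` in
`A_m` are indexed by the `n`-element sets `U` of positions among `m`. Taken as coefficients of the
monomials `e_U`, they form a homogeneous element `comps a m` of degree `n` in the Grassmann algebra
over `A_m` on `m` generators. The shuffle product is the top coefficient of a product of such
elements, the signs of shuffles being the signs of monomials. A family of Grassmann elements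
compatible with degeneracies is recovered from its top coefficient
(`SimplicialAlg.comps_eq_of_isCompatible`). Hence every algebraic law for chains reduces to a law in
Grassmann algebras.

In even degree `n > 0`, an element `f` is a sum of commuting terms `f_S e_S` of square zero. Its
`i`-th divided power is the `i`-th elementary symmetric polynomial in these terms, so `i! γ_i(f) =
f^i` (`IsHomog.factorial_smul_dpow`). The construction is natural in the coefficients and every
commutative ring is a quotient of a torsion-free one, so identities may be checked after
multiplication by factorials. A monomial of `γ_i(f)` contributes to the top coefficient only if its
sets `S` partition all positions into `i` blocks of size `n`; such partitions are the cosets of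
shuffles modulo block permutations.

Faces translate as follows for a normalized simplex. An inner face merges two adjacent generators
into their sum (`IsNormal.collapses`), and the last face removes the last generator
(`IsNormal.avoids`). Both properties pass to products and to positive divided powers, and both force
the top coefficient to vanish; so normalized simplices are closed under the operations. The face
`d_0` becomes contraction with the smallest generator, an antiderivation, which yields the Leibniz
rule and `d γ_i(c) = d(c) γ_{i-1}(c)`.

For a boundary `d_0 b`, the divided power of `b` is formed in the décalage of `A`, from which `d_0`
is a morphism to `A`; its image is `γ_i(d_0 b)`. All this applies to `ΓC`, because the inverse of
the transported Dold–Kan equivalence preserves commutative monoids. -/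

/-- The Grassmann algebra over `B` on generators indexed by a linear order `ι`. An element is given
by its coefficients at the basis elements `e_S = e_{s_1} ⋯ e_{s_n}`, where `s_1 < ⋯ < s_n` are the
elements of a finite set `S`. -/
def Grassmann (ι B : Type*) := Finset ι → B

/-! ### Signs and the ring structure of the Grassmann algebra. -/

namespace Grassmann

section Sign

variable {ι κ : Type*} [LinearOrder ι] [LinearOrder κ]

/-- The sign of the shuffle that sorts `U` followed by `V`. -/
def sgn (U V : Finset ι) : ℤ := ∏ u ∈ U, ∏ v ∈ V, if v < u then -1 else 1

@[simp] theorem sgn_empty_left (V : Finset ι) : sgn ∅ V = 1 := by simp [sgn]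

@[simp] theorem sgn_empty_right (U : Finset ι) : sgn U ∅ = 1 := by simp [sgn]

theorem sgn_union_left {U V : Finset ι} (h : Disjoint U V) (W : Finset ι) :
    sgn (U ∪ V) W = sgn U W * sgn V W := by
  simp [sgn, Finset.prod_union h]

theorem sgn_union_right (U : Finset ι) {V W : Finset ι} (h : Disjoint V W) :
    sgn U (V ∪ W) = sgn U V * sgn U W := by
  simp [sgn, Finset.prod_union h, Finset.prod_mul_distrib]

theorem sgn_map (e : ι ↪o κ) (U V : Finset ι) :
    sgn (U.map e.toEmbedding) (V.map e.toEmbedding) = sgn U V := by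
  simp [sgn]

/-- Each pair `(u, v)` is inverted in exactly one of the two orders, so it contributes `-1` to the
product of the two signs. -/
theorem sgn_comm {U V : Finset ι} (h : Disjoint U V) :
    sgn U V = (-1) ^ (U.card * V.card) * sgn V U := by
  have h2 : sgn V U = ∏ u ∈ U, ∏ v ∈ V, if u < v then -1 else 1 := Finset.prod_comm
  rw [h2, sgn, mul_comm U.card, pow_mul, ← Finset.prod_const, ← Finset.prod_mul_distrib]
  refine Finset.prod_congr rfl fun u hu => ?_
  rw [← Finset.prod_const, ← Finset.prod_mul_distrib]
  refine Finset.prod_congr rfl fun v hv => ?_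
  rcases lt_trichotomy u v with h3 | rfl | h3
  · simp [h3, h3.not_gt]
  · exact absurd hv (Finset.disjoint_left.1 h hu)
  · simp [h3, h3.not_gt]

end Sign

variable {ι κ B B' : Type*}

instance [AddCommGroup B] : AddCommGroup (Grassmann ι B) :=
  inferInstanceAs (AddCommGroup (Finset ι → B))

instance {R : Type*} [Semiring R] [AddCommGroup B] [Module R B] : Module R (Grassmann ι B) :=
  inferInstanceAs (Module R (Finset ι → B))

@[ext] theorem ext {f g : Grassmann ι B} (h : ∀ S, f S = g S) : f = g := funext h

@[simp] theorem add_apply [AddCommGroup B] (f g : Grassmann ι B) (S : Finset ι) :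
    (f + g) S = f S + g S := rfl

@[simp] theorem zero_apply [AddCommGroup B] (S : Finset ι) : (0 : Grassmann ι B) S = 0 := rfl

@[simp] theorem neg_apply [AddCommGroup B] (f : Grassmann ι B) (S : Finset ι) :
    (-f) S = -f S := rfl

@[simp] theorem smul_apply {R : Type*} [Semiring R] [AddCommGroup B] [Module R B] (r : R)
    (f : Grassmann ι B) (S : Finset ι) : (r • f) S = r • f S := rfl

@[simp] theorem zsmul_apply [AddCommGroup B] (n : ℤ) (f : Grassmann ι B) (S : Finset ι) :
    (n • f) S = n • f S := rfl

@[simp] theorem sum_apply [AddCommGroup B] {α : Type*} (s : Finset α) (f : α → Grassmann ι B)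
    (S : Finset ι) : (∑ x ∈ s, f x) S = ∑ x ∈ s, f x S := Finset.sum_apply S s f

variable [LinearOrder ι] [LinearOrder κ] [CommRing B] [CommRing B']

instance : Mul (Grassmann ι B) :=
  ⟨fun f g S => ∑ U ∈ S.powerset, (sgn U (S \ U) : B) * (f U * g (S \ U))⟩

instance : One (Grassmann ι B) := ⟨fun S => if S = ∅ then 1 else 0⟩

theorem mul_apply (f g : Grassmann ι B) (S : Finset ι) :
    (f * g) S = ∑ U ∈ S.powerset, (sgn U (S \ U) : B) * (f U * g (S \ U)) := rfl

theorem one_apply (S : Finset ι) : (1 : Grassmann ι B) S = if S = ∅ then 1 else 0 := rfl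

@[simp] theorem one_apply_empty : (1 : Grassmann ι B) ∅ = 1 := by simp [one_apply]

/-- Both sides run over ordered decompositions of `S` into three parts. The pair `(T, U)` with `U ⊆
T` corresponds to the pair `(U, T \ U)`, and the signs match because `sgn` is multiplicative in each
argument. -/
protected theorem mul_assoc' (f g h : Grassmann ι B) : f * g * h = f * (g * h) := by
  ext S
  simp only [mul_apply, Finset.mul_sum, Finset.sum_mul]
  rw [Finset.sum_sigma', Finset.sum_sigma']
  refine Finset.sum_bij' (fun x _ => ⟨x.2, x.1 \ x.2⟩) (fun x _ => ⟨x.1 ∪ x.2, x.1⟩) ?_ ?_ ?_ ?_ ?_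
  · rintro ⟨T, U⟩ h
    simp only [Finset.mem_sigma, Finset.mem_powerset] at h ⊢
    exact ⟨h.2.trans h.1, Finset.sdiff_subset_sdiff h.1 le_rfl⟩
  · rintro ⟨U, V⟩ h
    simp only [Finset.mem_sigma, Finset.mem_powerset] at h ⊢
    exact ⟨Finset.union_subset h.1 (h.2.trans Finset.sdiff_subset), Finset.subset_union_left⟩
  · rintro ⟨T, U⟩ h
    simp only [Finset.mem_sigma, Finset.mem_powerset] at h
    simp [Finset.union_sdiff_of_subset h.2]
  · rintro ⟨U, V⟩ h
    simp only [Finset.mem_sigma, Finset.mem_powerset] at h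
    have : Disjoint U V := (Finset.disjoint_sdiff.mono_right h.2)
    simp [Finset.union_sdiff_cancel_left this]
  · rintro ⟨T, U⟩ h
    simp only [Finset.mem_sigma, Finset.mem_powerset] at h
    obtain ⟨hT, hU⟩ := h
    have e1 : (S \ U) \ (T \ U) = S \ T := by
      ext x; simp only [Finset.mem_sdiff]; have := @hU x; tauto
    have e2 : S \ U = (T \ U) ∪ (S \ T) := by
      ext x; simp only [Finset.mem_sdiff, Finset.mem_union]
      have := @hU x; have := @hT x; tauto
    have d1 : Disjoint (T \ U) (S \ T) := Finset.disjoint_sdiff.mono_left Finset.sdiff_subset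
    have e3 : sgn T (S \ T) = sgn U (S \ T) * sgn (T \ U) (S \ T) := by
      rw [← sgn_union_left Finset.disjoint_sdiff, Finset.union_sdiff_of_subset hU]
    have e4 : sgn U (S \ U) = sgn U (T \ U) * sgn U (S \ T) := by
      rw [← sgn_union_right _ d1, ← e2]
    simp only [e1, e3, e4]
    push_cast
    ring

instance : Ring (Grassmann ι B) where
  __ := (inferInstance : AddCommGroup (Grassmann ι B))
  mul_assoc := Grassmann.mul_assoc'
  one_mul f := by
    ext S
    rw [mul_apply, Finset.sum_eq_single ∅]
    · simp
    · intro U _ hU; simp [one_apply, hU]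
    · simp
  mul_one f := by
    ext S
    rw [mul_apply, Finset.sum_eq_single S]
    · simp [one_apply]
    · intro U hU hne
      have : S \ U ≠ ∅ := fun h => hne ((Finset.mem_powerset.1 hU).antisymm (by simpa using h))
      simp only [one_apply, this, if_false, mul_zero]
    · simp
  left_distrib f g h := by
    ext S; simp [mul_apply, mul_add, Finset.sum_add_distrib]
  right_distrib f g h := by
    ext S; simp [mul_apply, mul_add, add_mul, Finset.sum_add_distrib]
  zero_mul f := by ext S; simp [mul_apply]
  mul_zero f := by ext S; simp [mul_apply]

section Module

variable {R : Type*} [CommRing R] [Algebra R B]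

theorem smul_mul' (r : R) (f g : Grassmann ι B) : (r • f) * g = r • (f * g) := by
  ext S; simp [mul_apply, Finset.smul_sum]

theorem mul_smul' (r : R) (f g : Grassmann ι B) : f * (r • g) = r • (f * g) := by
  ext S; simp [mul_apply, Finset.smul_sum]

end Module

/-- Change of coefficients. -/
def map (ψ : B →+* B') : Grassmann ι B →+* Grassmann ι B' where
  toFun f S := ψ (f S)
  map_one' := by ext S; simp [one_apply, apply_ite ψ]
  map_mul' f g := by
    ext S
    change ψ (∑ U ∈ S.powerset, (sgn U (S \ U) : B) * (f U * g (S \ U))) =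
      ∑ U ∈ S.powerset, (sgn U (S \ U) : B') * (ψ (f U) * ψ (g (S \ U)))
    simp
  map_zero' := funext fun _ => ψ.map_zero
  map_add' _ _ := funext fun _ => ψ.map_add _ _

@[simp] theorem map_apply (ψ : B →+* B') (f : Grassmann ι B) (S : Finset ι) :
    map ψ f S = ψ (f S) := rfl

/-- Restriction along an order embedding: generators outside the image are sent to zero. -/
def comap (e : ι ↪o κ) : Grassmann κ B →+* Grassmann ι B where
  toFun f S := f (S.map e.toEmbedding)
  map_one' := by ext S; simp [one_apply]
  map_mul' f g := by
    ext S
    simp only [mul_apply]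
    rw [show (S.map e.toEmbedding).powerset =
        S.powerset.map (Finset.mapEmbedding e.toEmbedding).toEmbedding by
      simp only [Finset.map_eq_image]
      exact Finset.powerset_image.trans (by congr 1; ext U : 1; simp [Finset.map_eq_image]),
      Finset.sum_map]
    refine Finset.sum_congr rfl fun U hU => ?_
    simp [← Finset.map_sdiff, sgn_map]
  map_zero' := rfl
  map_add' _ _ := rfl

@[simp] theorem comap_apply (e : ι ↪o κ) (f : Grassmann κ B) (S : Finset ι) :
    comap e f S = f (S.map e.toEmbedding) := rfl

/-- The multiple `b • e_S` of a basis element. -/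
def single (S : Finset ι) (b : B) : Grassmann ι B := fun T => if T = S then b else 0

theorem single_apply (S T : Finset ι) (b : B) :
    single S b T = if T = S then b else 0 := rfl

@[simp] theorem single_zero (S : Finset ι) : single S (0 : B) = 0 := by
  ext T; simp [single_apply]

theorem single_mul_single (S T : Finset ι) (b c : B) :
    single S b * single T c =
      if Disjoint S T then single (S ∪ T) ((sgn S T : B) * (b * c)) else 0 := by
  ext W
  rw [mul_apply]
  by_cases hS : S ⊆ W
  · rw [Finset.sum_eq_single S]
    · by_cases hT : W \ S = T
      · subst hT
        simp [single_apply, Finset.disjoint_sdiff, Finset.union_sdiff_of_subset hS]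
      · split_ifs with hd
        · have : W ≠ S ∪ T := by
            rintro rfl; exact hT (Finset.union_sdiff_cancel_left hd)
          simp [single_apply, hT, this]
        · simp [single_apply, hT]
    · intro U _ hU; simp [single_apply, hU]
    · intro h; exact absurd (Finset.mem_powerset.2 hS) h
  · rw [Finset.sum_eq_zero]
    · split_ifs with hd
      · have : W ≠ S ∪ T := by
          rintro rfl; exact hS Finset.subset_union_left
        simp [single_apply, this]
      · rfl
    · intro U hU
      have : U ≠ S := by rintro rfl; exact hS (Finset.mem_powerset.1 hU)
      simp [single_apply, this]

theorem single_mul_self {S : Finset ι} (hS : S.Nonempty) (b : B) :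
    single S b * single S b = 0 := by
  rw [single_mul_single, if_neg]
  simpa using hS.ne_empty

theorem map_single (ψ : B →+* B') (S : Finset ι) (b : B) :
    map ψ (single S b) = single S (ψ b) := by
  ext T; simp [single_apply, apply_ite ψ]

theorem sum_single [Fintype ι] (f : Grassmann ι B) : ∑ S, single S (f S) = f := by
  ext T
  rw [sum_apply, Finset.sum_eq_single T] <;> simp +contextual [single_apply, eq_comm]

/-! ### Homogeneous elements -/

/-- Homogeneous elements of degree `n`. -/
def IsHomog (n : ℕ) (f : Grassmann ι B) : Prop := ∀ S, S.card ≠ n → f S = 0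

namespace IsHomog

variable {n p q : ℕ} {f g : Grassmann ι B}

protected theorem add (hf : IsHomog n f) (hg : IsHomog n g) : IsHomog n (f + g) :=
  fun S hS => by simp [hf S hS, hg S hS]

protected theorem one : IsHomog 0 (1 : Grassmann ι B) := fun S hS => by
  have : S ≠ ∅ := by rintro rfl; simp at hS
  simp [one_apply, this]

protected theorem zero : IsHomog n (0 : Grassmann ι B) := fun _ _ => rfl

protected theorem mul (hf : IsHomog p f) (hg : IsHomog q g) : IsHomog (p + q) (f * g) := by
  intro S hS
  rw [mul_apply]
  refine Finset.sum_eq_zero fun U hU => ?_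
  by_cases h : U.card = p
  · rw [hg (S \ U), mul_zero, mul_zero]
    rw [Finset.card_sdiff_of_subset (Finset.mem_powerset.1 hU)]
    have := Finset.card_le_card (Finset.mem_powerset.1 hU)
    omega
  · rw [hf U h]; simp

protected theorem pow (hf : IsHomog n f) (i : ℕ) : IsHomog (n * i) (f ^ i) := by
  induction i with
  | zero => simpa using IsHomog.one
  | succ i ih => rw [pow_succ]; exact ih.mul hf

protected theorem map (hf : IsHomog n f) (ψ : B →+* B') : IsHomog n (map ψ f) :=
  fun S hS => by simp [hf S hS]

protected theorem comap {f : Grassmann κ B} (hf : IsHomog n f) (e : ι ↪o κ) :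
    IsHomog n (comap e f) :=
  fun S hS => by rw [comap_apply, hf]; simpa using hS

/-- Complementation in `S` exchanges the two sums; `sgn_comm` supplies the sign. -/
protected theorem mul_comm (hf : IsHomog p f) (hg : IsHomog q g) :
    f * g = (-1 : ℤ) ^ (p * q) • (g * f) := by
  ext S
  rw [zsmul_apply, mul_apply, mul_apply, Finset.smul_sum]
  refine Finset.sum_bij' (fun U _ => S \ U) (fun U _ => S \ U) (by simp) (by simp) ?_ ?_ ?_
  · intro U hU; exact Finset.sdiff_sdiff_eq_self (Finset.mem_powerset.1 hU)
  · intro U hU; exact Finset.sdiff_sdiff_eq_self (Finset.mem_powerset.1 hU)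
  · intro U hU
    rw [Finset.sdiff_sdiff_eq_self (Finset.mem_powerset.1 hU)]
    by_cases hp : U.card = p
    · by_cases hq : (S \ U).card = q
      · rw [sgn_comm Finset.disjoint_sdiff, hp, hq, zsmul_eq_mul]
        push_cast
        ring
      · simp [hg _ hq]
    · simp [hf _ hp]

protected theorem commute (hf : IsHomog p f) (hg : IsHomog q g) (hp : Even p) : Commute f g := by
  have := hf.mul_comm hg
  rwa [(hp.mul_right q).neg_one_pow, one_smul] at this

/-- Homogeneous elements of odd degree have square zero. -/
protected theorem mul_self (hf : IsHomog n f) (hn : Odd n) : f * f = 0 := by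
  ext S
  rw [mul_apply]
  -- The terms of `U` and `S \ U` cancel, which avoids a division by 2. A fixed point would be the
  -- empty set, where `f` vanishes because its degree is odd.
  refine Finset.sum_involution (fun U _ => S \ U) ?_ ?_ (by simp) ?_
  · intro U hU
    rw [Finset.sdiff_sdiff_eq_self (Finset.mem_powerset.1 hU)]
    by_cases hp : U.card = n
    · by_cases hq : (S \ U).card = n
      · rw [sgn_comm Finset.disjoint_sdiff, hp, hq, (hn.mul hn).neg_one_pow]
        push_cast
        ring
      · simp [hf _ hq]
    · simp [hf _ hp]
  · intro U hU hne h
    rw [h] at hne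
    have h2 : Disjoint U (S \ U) := Finset.disjoint_sdiff
    rw [h, disjoint_self] at h2
    refine hne ?_
    rw [hf U]
    · simp
    · rw [h2]; rintro h3; simp at h3; rw [← h3] at hn; simp at hn
  · intro U hU; exact Finset.sdiff_sdiff_eq_self (Finset.mem_powerset.1 hU)

end IsHomog

end Grassmann

namespace Grassmann

/-! ### Divided powers -/

section EvenSubring

variable (ι B : Type*) [LinearOrder ι] [CommRing B]

/-- The subring of elements that are supported on sets of even cardinality. -/
def evenSubring : Subring (Grassmann ι B) where
  carrier := {f | ∀ S : Finset ι, Odd S.card → f S = 0}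
  zero_mem' := fun _ _ => rfl
  one_mem' := fun S hS => by
    have : S ≠ ∅ := by rintro rfl; simp at hS
    simp [one_apply, this]
  add_mem' := fun hf hg S hS => by simp [hf S hS, hg S hS]
  neg_mem' := fun hf S hS => by simp [hf S hS]
  mul_mem' := fun {f g} hf hg S hS => by
    rw [mul_apply]
    refine Finset.sum_eq_zero fun U hU => ?_
    rcases Nat.even_or_odd U.card with h | h
    · rw [hg (S \ U), mul_zero, mul_zero]
      rw [Finset.card_sdiff_of_subset (Finset.mem_powerset.1 hU)]
      exact Nat.Odd.sub_even (Finset.card_le_card (Finset.mem_powerset.1 hU)) hS h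
    · simp [hf U h]

/-- Commutativity makes products over unordered finite sets available, and with them the elementary
symmetric polynomials that define `dpow`. -/
instance : CommRing (evenSubring ι B) where
  mul_comm := by
    rintro ⟨f, hf⟩ ⟨g, hg⟩
    ext S : 2
    change (f * g) S = (g * f) S
    rw [mul_apply, mul_apply]
    refine Finset.sum_bij' (fun U _ => S \ U) (fun U _ => S \ U) (by simp) (by simp) ?_ ?_ ?_
    · intro U hU; exact Finset.sdiff_sdiff_eq_self (Finset.mem_powerset.1 hU)
    · intro U hU; exact Finset.sdiff_sdiff_eq_self (Finset.mem_powerset.1 hU)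
    · intro U hU
      rw [Finset.sdiff_sdiff_eq_self (Finset.mem_powerset.1 hU)]
      rcases Nat.even_or_odd U.card with h | h
      · rw [sgn_comm Finset.disjoint_sdiff, (h.mul_right _).neg_one_pow]
        push_cast
        ring
      · simp [hf _ h]

end EvenSubring

variable {ι κ B B' : Type*} [LinearOrder ι] [LinearOrder κ] [CommRing B] [CommRing B']

/-- The multiple `b • e_S` of a basis element of even degree; zero if the degree is odd. -/
def evenSingle (S : Finset ι) (b : B) : evenSubring ι B :=
  ⟨if Even S.card then single S b else 0, fun T hT => by
    split_ifs with h
    · have : T ≠ S := by rintro rfl; exact (Nat.not_even_iff_odd.2 hT) h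
      simp [single_apply, this]
    · rfl⟩

/-- Change of coefficients on elements of even degree. -/
def evenMap (ψ : B →+* B') : evenSubring ι B →+* evenSubring ι B' :=
  (map ψ).restrict _ _ fun f hf S hS => by simp [hf S hS]

theorem coe_evenMap (ψ : B →+* B') (f : evenSubring ι B) :
    (evenMap ψ f : Grassmann ι B') = map ψ (f : Grassmann ι B) := rfl

theorem evenMap_evenSingle (ψ : B →+* B') (S : Finset ι) (b : B) :
    evenMap ψ (evenSingle S b) = evenSingle S (ψ b) := by
  apply Subtype.ext
  rw [coe_evenMap, evenSingle, evenSingle]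
  simp only [apply_ite (map ψ), map_single, map_zero]

/-- The `i`-th divided power on the even part of the Grassmann algebra: the `i`-th elementary
symmetric polynomial in the components, which have square zero. -/
def dpow [Fintype ι] (i : ℕ) (f : Grassmann ι B) : Grassmann ι B :=
  ((∑ T ∈ Finset.univ.powersetCard i, ∏ S ∈ T, evenSingle S (f S) : evenSubring ι B) :
    Grassmann ι B)

@[simp] theorem dpow_zero [Fintype ι] (f : Grassmann ι B) : dpow 0 f = 1 := by simp [dpow]

theorem map_dpow [Fintype ι] (ψ : B →+* B') (i : ℕ) (f : Grassmann ι B) :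
    map ψ (dpow i f) = dpow i (map ψ f) := by
  simp only [dpow, ← coe_evenMap, map_sum, map_prod, evenMap_evenSingle, map_apply]

theorem add_pow_succ_of_mul_self_eq_zero {A : Type*} [CommRing A] {t : A} (ht : t * t = 0) (x : A)
    (i : ℕ) : (t + x) ^ (i + 1) = x ^ (i + 1) + ((i + 1 : ℕ) : A) * (t * x ^ i) := by
  induction i with
  | zero => simp [add_comm]
  | succ i ih =>
    rw [pow_succ, ih]
    push_cast
    linear_combination ((i + 1 : A) * x ^ i) * ht

/-- In the expansion of the `i`-th power, monomials with a repeated factor vanish and each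
squarefree one occurs `i!` times. The induction sorts the sets `T` by whether they contain the new
element. -/
theorem factorial_smul_sum_prod {α A : Type*} [CommRing A] [DecidableEq α] (s : Finset α)
    (t : α → A) (ht : ∀ a ∈ s, t a * t a = 0) (i : ℕ) :
    i ! • ∑ T ∈ s.powersetCard i, ∏ a ∈ T, t a = (∑ a ∈ s, t a) ^ i := by
  induction s using Finset.induction_on generalizing i with
  | empty =>
    cases i with
    | zero => simp
    | succ i => simp [Finset.powersetCard_eq_empty.2 (show (∅ : Finset α).card < i + 1 by simp)]
  | insert a s ha ih =>
    have ih' := ih fun b hb => ht b (Finset.mem_insert_of_mem hb)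
    cases i with
    | zero => simp
    | succ i =>
      rw [Finset.powersetCard_succ_insert ha, Finset.sum_union, smul_add, ih',
        Finset.sum_image, Finset.sum_insert ha]
      · have : ∀ T ∈ s.powersetCard i, ∏ b ∈ insert a T, t b = t a * ∏ b ∈ T, t b := by
          intro T hT
          rw [Finset.prod_insert]
          exact fun h => ha ((Finset.mem_powersetCard.1 hT).1 h)
        rw [Finset.sum_congr rfl this, ← Finset.mul_sum, Nat.factorial_succ, mul_smul,
          ← mul_smul_comm, ih', add_pow_succ_of_mul_self_eq_zero (ht a (Finset.mem_insert_self a s)),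
          nsmul_eq_mul]
      · intro T hT T' hT' h
        have h1 : a ∉ T := fun h => ha ((Finset.mem_powersetCard.1 hT).1 h)
        have h2 : a ∉ T' := fun h => ha ((Finset.mem_powersetCard.1 hT').1 h)
        rw [← Finset.erase_insert h1, ← Finset.erase_insert h2, h]
      · rw [Finset.disjoint_left]
        intro T hT hT'
        obtain ⟨T', _, rfl⟩ := Finset.mem_image.1 hT'
        exact ha ((Finset.mem_powersetCard.1 hT).1 (Finset.mem_insert_self a T'))

theorem IsHomog.sum_evenSingle [Fintype ι] {n : ℕ} {f : Grassmann ι B} (hf : IsHomog n f)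
    (hn : Even n) :
    ((∑ S, evenSingle S (f S) : evenSubring ι B) : Grassmann ι B) = f := by
  conv_rhs => rw [← sum_single f]
  rw [AddSubmonoidClass.coe_finsetSum]
  refine Finset.sum_congr rfl fun S _ => ?_
  by_cases h : S.card = n
  · simp [evenSingle, h, hn]
  · simp [evenSingle, hf S h]

theorem evenSingle_mul_self {n : ℕ} {f : Grassmann ι B} (hf : IsHomog n f) (hn : 0 < n)
    (S : Finset ι) : evenSingle S (f S) * evenSingle S (f S) = 0 := by
  apply Subtype.ext
  change (evenSingle S (f S) : Grassmann ι B) * evenSingle S (f S) = 0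
  by_cases h : S.card = n
  · have : S.Nonempty := Finset.card_pos.1 (h ▸ hn)
    simp only [evenSingle]
    split_ifs
    · exact single_mul_self this _
    · simp
  · simp [evenSingle, hf S h]

/-- Over torsion-free coefficients this equation determines `dpow`. Together with `map_dpow` it is
the source of the divided power identities in even degree. -/
theorem IsHomog.factorial_smul_dpow [Fintype ι] {n : ℕ} {f : Grassmann ι B} (hf : IsHomog n f)
    (hn : Even n)
    (hn0 : 0 < n) (i : ℕ) : i ! • dpow i f = f ^ i := by
  classical
  conv_rhs => rw [← hf.sum_evenSingle hn]
  rw [dpow, ← SubmonoidClass.coe_pow,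
    ← factorial_smul_sum_prod _ _ (fun S _ => evenSingle_mul_self hf hn0 S)]
  simp

/-- Every commutative ring is a quotient of a torsion-free one. -/
theorem exists_torsionFree_lift (B : Type u) [CommRing B] :
    ∃ (P : Type u) (_ : CommRing P) (_ : IsAddTorsionFree P) (π : P →+* B) (s : B → P),
      s 0 = 0 ∧ ∀ b, π (s b) = b := by
  classical
  -- The section is set to zero at `0`, so that coefficientwise lifts of homogeneous elements stay
  -- homogeneous.
  refine ⟨MvPolynomial B ℤ, inferInstance, inferInstance, (MvPolynomial.aeval id).toRingHom,
    fun b => if b = 0 then 0 else MvPolynomial.X b, by simp, fun b => ?_⟩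
  by_cases h : b = 0 <;> simp [h]

theorem factorial_smul_cancel [IsAddTorsionFree B] (i : ℕ) {f g : Grassmann ι B}
    (h : i ! • f = i ! • g) : f = g := by
  ext S
  exact nsmul_right_injective (Nat.factorial_ne_zero i) (congrFun h S)

end Grassmann

/-! ### Divided power identities in even degree, by reduction to torsion-free coefficients. -/

namespace Grassmann

section Lift

variable {ι B P : Type*} [CommRing B] [CommRing P] {s : B → P} {π : P →+* B}

/-- Application of a map to all coefficients. -/
def mapFun (s : B → P) (f : Grassmann ι B) : Grassmann ι P := fun S => s (f S)

theorem map_mapFun [LinearOrder ι] (hπ : ∀ b, π (s b) = b) (f : Grassmann ι B) :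
    map π (mapFun s f) = f := by
  ext S; simp [mapFun, hπ]

protected theorem IsHomog.mapFun (hs : s 0 = 0) {n : ℕ} {f : Grassmann ι B} (hf : IsHomog n f) :
    IsHomog n (mapFun s f) := fun S hS => by simp [mapFun, hf S hS, hs]

end Lift

variable {ι κ : Type*} [LinearOrder ι] [LinearOrder κ] [Fintype ι] [Fintype κ] {B : Type u}
  [CommRing B] {n p q : ℕ} {f g : Grassmann ι B}

theorem IsHomog.dpow_one (hf : IsHomog n f) (hn : Even n) (hn0 : 0 < n) : dpow 1 f = f := by
  simpa using hf.factorial_smul_dpow hn hn0 1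

/-- The pattern used throughout: lift the coefficients to a torsion-free ring, multiply by a
factorial to replace divided powers by ordinary powers, cancel the factorial, and descend by
`map_dpow`. -/
protected theorem IsHomog.dpow (hf : IsHomog n f) (hn : Even n) (hn0 : 0 < n) (i : ℕ) :
    IsHomog (n * i) (dpow i f) := by
  obtain ⟨P, _, _, π, s, hs, hπ⟩ := exists_torsionFree_lift B
  rw [← map_mapFun hπ f, ← map_dpow]
  refine IsHomog.map (fun S hS => ?_) π
  have h1 := (hf.mapFun hs).factorial_smul_dpow hn hn0 i
  have h2 := (hf.mapFun hs).pow i S hS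
  rw [← h1] at h2
  exact (smul_eq_zero_iff_right (Nat.factorial_ne_zero i)).1 h2

theorem IsHomog.dpow_mul_dpow (hf : IsHomog n f) (hn : Even n) (hn0 : 0 < n) (i j : ℕ) :
    dpow i f * dpow j f = (i + j).choose i • dpow (i + j) f := by
  obtain ⟨P, _, _, π, s, hs, hπ⟩ := exists_torsionFree_lift B
  rw [← map_mapFun hπ f]
  simp only [← map_dpow, ← map_mul, ← map_nsmul]
  congr 1
  have h := (hf.mapFun hs).factorial_smul_dpow hn hn0
  apply factorial_smul_cancel i
  apply factorial_smul_cancel j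
  rw [← smul_mul_assoc, h, ← mul_smul_comm, h, ← pow_add, ← h, smul_smul, smul_smul,
    ← Nat.add_choose_mul_factorial_mul_factorial i j, Nat.choose_symm_add]
  congr 1
  ring

theorem IsHomog.dpow_add (hf : IsHomog n f) (hg : IsHomog n g) (hn : Even n) (hn0 : 0 < n)
    (i : ℕ) : dpow i (f + g) =
      ∑ k ∈ Finset.HasAntidiagonal.antidiagonal i, dpow k.1 f * dpow k.2 g := by
  obtain ⟨P, _, _, π, s, hs, hπ⟩ := exists_torsionFree_lift B
  rw [← map_mapFun hπ f, ← map_mapFun hπ g]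
  simp only [← map_dpow, ← map_mul, ← map_add, ← map_sum]
  congr 1
  have hf' := hf.mapFun hs
  have hg' := hg.mapFun hs
  apply factorial_smul_cancel i
  rw [(hf'.add hg').factorial_smul_dpow hn hn0, (hf'.commute hg' hn).add_pow', Finset.smul_sum]
  refine Finset.sum_congr rfl fun k hk => ?_
  have hk := Finset.HasAntidiagonal.mem_antidiagonal.1 hk
  rw [← hf'.factorial_smul_dpow hn hn0, ← hg'.factorial_smul_dpow hn hn0, smul_mul_assoc,
    mul_smul_comm, smul_smul, smul_smul, ← hk, ← Nat.add_choose_mul_factorial_mul_factorial,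
    ← Nat.choose_symm_add, mul_assoc]

theorem IsHomog.dpow_mul (hf : IsHomog p f) (hg : IsHomog q g) (hp : Even p) (hq : Even q)
    (hq0 : 0 < q) (i : ℕ) : dpow i (f * g) = f ^ i * dpow i g := by
  obtain ⟨P, _, _, π, s, hs, hπ⟩ := exists_torsionFree_lift B
  rw [← map_mapFun hπ f, ← map_mapFun hπ g]
  simp only [← map_dpow, ← map_mul, ← map_pow]
  congr 1
  have hf' := hf.mapFun hs
  have hg' := hg.mapFun hs
  apply factorial_smul_cancel i
  rw [(hf'.mul hg').factorial_smul_dpow (hp.add hq) (by omega), ← mul_smul_comm,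
    hg'.factorial_smul_dpow hq hq0, (hf'.commute hg' hp).mul_pow]

/-- After multiplication by `i!`, the power `(f g)^i` with `i ≥ 2` has the factor `f g f g`, which
is `± f f g g` and vanishes since `f` is odd. -/
theorem IsHomog.dpow_mul_of_odd (hf : IsHomog p f) (hg : IsHomog q g) (hp : Odd p) (hq : Odd q)
    {i : ℕ} (hi : 1 < i) : dpow i (f * g) = 0 := by
  obtain ⟨P, _, _, π, s, hs, hπ⟩ := exists_torsionFree_lift B
  rw [← map_mapFun hπ f, ← map_mapFun hπ g]
  simp only [← map_dpow, ← map_mul]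
  rw [← map_zero (map π)]
  congr 1
  have hf' := hf.mapFun hs
  have hg' := hg.mapFun hs
  apply factorial_smul_cancel i
  rw [(hf'.mul hg').factorial_smul_dpow (hp.add_odd hq) (by have := hp.pos; omega), smul_zero]
  obtain ⟨k, rfl⟩ := Nat.exists_eq_add_of_lt hi
  rw [show 1 + k + 1 = 2 + k by ring, pow_add, sq,
    show mapFun s f * mapFun s g * (mapFun s f * mapFun s g) =
      mapFun s f * (mapFun s g * mapFun s f) * mapFun s g by noncomm_ring,
    hg'.mul_comm hf', mul_smul_comm, smul_mul_assoc, ← mul_assoc, hf'.mul_self hp]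
  simp

theorem IsHomog.dpow_dpow (hf : IsHomog n f) (hn : Even n) (hn0 : 0 < n) (i : ℕ) {j : ℕ}
    (hj : 0 < j) : dpow i (dpow j f) =
      ((i * j) ! / (i ! * (j !) ^ i)) • dpow (i * j) f := by
  obtain ⟨P, _, _, π, s, hs, hπ⟩ := exists_torsionFree_lift B
  rw [← map_mapFun hπ f]
  simp only [← map_dpow, ← map_nsmul]
  congr 1
  have hf' := hf.mapFun hs
  -- The quotient counts the partitions of a set of `i * j` elements into `i` blocks of size `j`.
  have hdvd : i ! * (j !) ^ i ∣ (i * j) ! := by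
    rw [← Nat.uniformBell_mul_eq i hj.ne']
    exact ⟨Nat.uniformBell i j, by ring⟩
  ext S
  apply nsmul_right_injective
    (Nat.mul_ne_zero (Nat.factorial_ne_zero i) (pow_ne_zero i (Nat.factorial_ne_zero j)))
  suffices h : (i ! * j ! ^ i) • dpow i (dpow j (mapFun s f)) =
      (i ! * j ! ^ i) • ((i * j) ! / (i ! * (j !) ^ i)) • dpow (i * j) (mapFun s f) from
    congrFun h S
  rw [smul_smul, Nat.mul_div_cancel' hdvd, hf'.factorial_smul_dpow hn hn0, mul_comm (i !), mul_smul,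
    (hf'.dpow hn hn0 j).factorial_smul_dpow (hn.mul_right j) (Nat.mul_pos hn0 hj), ← smul_pow,
    hf'.factorial_smul_dpow hn hn0, ← pow_mul, mul_comm]

/-- Restriction is a ring homomorphism, so it respects powers and hence, over torsion-free
coefficients, divided powers. This gives the compatibility of divided powers with degeneracies. -/
theorem IsHomog.comap_dpow (hf : IsHomog n f) (hn : Even n) (hn0 : 0 < n) (e : κ ↪o ι) (i : ℕ) :
    comap e (dpow i f) = dpow i (comap e f) := by
  obtain ⟨P, _, _, π, s, hs, hπ⟩ := exists_torsionFree_lift B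
  have h (g : Grassmann ι P) : comap e (map π g) = map π (comap e g) := rfl
  rw [← map_mapFun hπ f, h, ← map_dpow, ← map_dpow, h]
  congr 1
  have hf' := hf.mapFun hs
  apply factorial_smul_cancel i
  rw [← map_nsmul, hf'.factorial_smul_dpow hn hn0, (hf'.comap e).factorial_smul_dpow hn hn0,
    map_pow]

end Grassmann

namespace Grassmann

/-! ### Contraction with the smallest generator -/

section Contraction

variable {m n p : ℕ} {B : Type u} [CommRing B]

/-- The ring homomorphism that sends the smallest generator to zero. -/
def res : Grassmann (Fin (m + 1)) B →+* Grassmann (Fin m) B := comap (Fin.succOrderEmb m)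

/-- The contraction with the smallest generator: the part `g` in the decomposition
`f = f' + e_0 g`. -/
def contr (f : Grassmann (Fin (m + 1)) B) : Grassmann (Fin m) B :=
  fun T => f (insert 0 (T.map (Fin.succEmb m)))

theorem res_apply (f : Grassmann (Fin (m + 1)) B) (T : Finset (Fin m)) :
    res f T = f (T.map (Fin.succEmb m)) := rfl

theorem zero_notMem_map_succ (T : Finset (Fin m)) : (0 : Fin (m + 1)) ∉ T.map (Fin.succEmb m) := by
  simp

theorem sgn_insert_zero_left (U V : Finset (Fin m)) :
    sgn (insert 0 (U.map (Fin.succEmb m))) (V.map (Fin.succEmb m)) = sgn U V := by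
  rw [sgn, Finset.prod_insert (zero_notMem_map_succ U)]
  simp [sgn]

/-- Bringing `e_0` to the front past `e_U` costs one transposition for each element of `U`. -/
theorem sgn_insert_zero_right (U V : Finset (Fin m)) :
    sgn (U.map (Fin.succEmb m)) (insert 0 (V.map (Fin.succEmb m))) = (-1) ^ U.card * sgn U V := by
  rw [sgn]
  simp only [Finset.prod_insert (zero_notMem_map_succ V)]
  simp [sgn, Finset.prod_neg]

theorem univ_fin_succ_eq : (Finset.univ : Finset (Fin (m + 1))) =
    insert 0 ((Finset.univ : Finset (Fin m)).map (Fin.succEmb m)) := by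
  rw [Fin.univ_succ, Finset.cons_eq_insert]
  rfl

omit [CommRing B] in
theorem contr_apply_univ (f : Grassmann (Fin (m + 1)) B) :
    contr f Finset.univ = f Finset.univ := by
  rw [contr, univ_fin_succ_eq]

theorem IsHomog.contr {f : Grassmann (Fin (m + 1)) B} (hf : IsHomog (n + 1) f) :
    IsHomog n (contr f) := fun T hT => hf _ <| by
  rw [Finset.card_insert_of_notMem (zero_notMem_map_succ T), Finset.card_map]
  omega

/-- In a monomial of `f * g` that contains `e_0`, this generator comes either from `f` or from `g`.
In the second case it is moved past a part of degree `p`. This is the origin of the Leibniz rule. -/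
theorem contr_mul {f : Grassmann (Fin (m + 1)) B} (hf : IsHomog p f)
    (g : Grassmann (Fin (m + 1)) B) :
    contr (f * g) = contr f * res g + (-1 : ℤ) ^ p • (res f * contr g) := by
  ext T
  rw [contr, mul_apply, Finset.sum_powerset_insert (zero_notMem_map_succ T), add_apply, add_comm]
  have hp : (T.map (Fin.succEmb m)).powerset =
      T.powerset.map (Finset.mapEmbedding (Fin.succEmb m)).toEmbedding := by
    simp only [Finset.map_eq_image]
    exact Finset.powerset_image.trans (by congr 1; ext U : 1; simp [Finset.map_eq_image])
  rw [hp, Finset.sum_map, Finset.sum_map, zsmul_apply, mul_apply, mul_apply, Finset.smul_sum]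
  congr 1
  · refine Finset.sum_congr rfl fun U hU => ?_
    have : insert 0 (T.map (Fin.succEmb m)) \ insert 0 (U.map (Fin.succEmb m)) =
        (T \ U).map (Fin.succEmb m) := by
      rw [Finset.insert_sdiff_insert, Finset.sdiff_insert_of_notMem (zero_notMem_map_succ T),
        Finset.map_sdiff]
    simp only [RelEmbedding.coe_toEmbedding, Finset.mapEmbedding_apply, this,
      sgn_insert_zero_left]
    rfl
  · refine Finset.sum_congr rfl fun U hU => ?_
    have : insert 0 (T.map (Fin.succEmb m)) \ (U.map (Fin.succEmb m)) =
        insert 0 ((T \ U).map (Fin.succEmb m)) := by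
      rw [Finset.insert_sdiff_of_notMem _ (zero_notMem_map_succ U), Finset.map_sdiff]
    simp only [RelEmbedding.coe_toEmbedding, Finset.mapEmbedding_apply, this,
      sgn_insert_zero_right]
    by_cases h : U.card = p
    · rw [h, zsmul_eq_mul]
      push_cast
      rw [mul_assoc]
      rfl
    · have h1 : f (U.map (Fin.succEmb m)) = 0 := hf _ (by simpa using h)
      have h2 : res f U = 0 := h1
      simp [h1, h2]

theorem contr_pow {f : Grassmann (Fin (m + 1)) B} (hf : IsHomog (n + 1) f) (hn : Even (n + 1))
    (i : ℕ) : contr (f ^ (i + 1)) = (i + 1) • (contr f * res f ^ i) := by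
  induction i with
  | zero => simp
  | succ i ih =>
    have hc : contr f * res f = res f * contr f :=
      ((hf.comap (Fin.succOrderEmb m)).commute hf.contr hn).eq.symm
    have hc' : contr f * res f ^ (i + 1) = res f ^ (i + 1) * contr f := Commute.pow_right hc (i + 1)
    rw [pow_succ f, contr_mul (hf.pow (i + 1)), ih, (hn.mul_right _).neg_one_pow, one_smul, map_pow,
      ← hc', smul_mul_assoc, mul_assoc, ← pow_succ, ← succ_nsmul]

/-- Multiplied by `(i + 1)!`, this becomes `contr_pow`, whose factor `i + 1` is the ratio of the two
factorials. It is the origin of the formula for the boundary of a divided power. -/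
theorem contr_dpow {f : Grassmann (Fin (m + 1)) B} (hf : IsHomog (n + 1) f) (hn : Even (n + 1))
    (i : ℕ) : contr (dpow (i + 1) f) = contr f * dpow i (res f) := by
  obtain ⟨P, _, _, π, s, hs, hπ⟩ := exists_torsionFree_lift B
  have h (g : Grassmann (Fin (m + 1)) P) : contr (map π g) = map π (contr g) := rfl
  have h' (g : Grassmann (Fin (m + 1)) P) : res (map π g) = map π (res g) := rfl
  rw [← map_mapFun hπ f, h, h', ← map_dpow, ← map_dpow, ← map_mul, h]
  congr 1
  have hf' := hf.mapFun hs
  have h2 (k : ℕ) (g : Grassmann (Fin (m + 1)) P) : k • contr g = contr (k • g) := rfl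
  apply factorial_smul_cancel (i + 1)
  rw [h2, hf'.factorial_smul_dpow hn n.succ_pos, contr_pow hf' hn, Nat.factorial_succ, mul_smul,
    ← mul_smul_comm i !]
  congr 2
  exact ((hf'.comap (Fin.succOrderEmb m)).factorial_smul_dpow hn n.succ_pos i).symm

end Contraction

/-! ### Criteria for the vanishing of top coefficients -/

section Vanishing

variable {ι : Type*} [LinearOrder ι] {B : Type u} [CommRing B] {n : ℕ} {f g : Grassmann ι B}
  {s t : ι}

/-- The generator `e_s` does not occur in `f`. -/
def Avoids (s : ι) (f : Grassmann ι B) : Prop := ∀ S, s ∈ S → f S = 0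

theorem Avoids.mul (hf : Avoids s f) (hg : Avoids s g) : Avoids s (f * g) := by
  intro S hS
  rw [mul_apply]
  refine Finset.sum_eq_zero fun U hU => ?_
  by_cases h : s ∈ U
  · simp [hf U h]
  · simp [hg (S \ U) (by simp [hS, h])]

theorem Avoids.pow_succ (hf : Avoids s f) (i : ℕ) : Avoids s (f ^ (i + 1)) := by
  induction i with
  | zero => simpa using hf
  | succ i ih => rw [_root_.pow_succ]; exact ih.mul hf

theorem Avoids.dpow_succ [Fintype ι] (hf : Avoids s f) (hn : IsHomog n f) (hn2 : Even n)
    (hn0 : 0 < n) (i : ℕ) : Avoids s (dpow (i + 1) f) := by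
  obtain ⟨P, _, _, π, r, hr, hπ⟩ := exists_torsionFree_lift B
  intro S hS
  have h1 : Avoids s (mapFun r f) := fun T hT => by simp [mapFun, hf T hT, hr]
  have h2 := h1.pow_succ i S hS
  rw [← (hn.mapFun hr).factorial_smul_dpow hn2 hn0] at h2
  have h3 := (smul_eq_zero_iff_right (Nat.factorial_ne_zero (i + 1))).1 h2
  rw [← map_mapFun hπ f, ← map_dpow, map_apply, h3, _root_.map_zero]

/-- The elements `f` that come from the Grassmann algebra in which the generators `e_s` and `e_t`
are replaced by their sum. -/
structure Collapses (s t : ι) (f : Grassmann ι B) : Prop where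
  eq_zero : ∀ S, s ∈ S → t ∈ S → f S = 0
  map_swap : ∀ S : Finset ι, f (S.map (Equiv.swap s t).toEmbedding) = f S

/-- Since nothing lies between `s` and `t`, exchanging them changes the relative order of no pair
other than `s` and `t` themselves. -/
theorem sgn_map_swap (hst : s < t) (hadj : ∀ x, x ≠ s → x ≠ t → (x < s ↔ x < t))
    (U V : Finset ι) :
    sgn (U.map (Equiv.swap s t).toEmbedding) (V.map (Equiv.swap s t).toEmbedding) =
      (if s ∈ U ∧ t ∈ V then -1 else 1) * (if t ∈ U ∧ s ∈ V then -1 else 1) * sgn U V := by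
  have key : ∀ u v, (if (Equiv.swap s t) v < (Equiv.swap s t) u then (-1 : ℤ) else 1) =
      (if u = s then if v = t then -1 else 1 else 1) *
        (if u = t then if v = s then -1 else 1 else 1) * if v < u then -1 else 1 := by
    intro u v
    have hts := hst.not_gt
    have hne := hst.ne
    have hne' := hst.ne'
    by_cases hus : u = s
    · subst hus
      by_cases hvt : v = t
      · subst hvt; simp [hst, hts, hne]
      · by_cases hvu : v = u
        · subst hvu; simp [hvt]
        · rw [Equiv.swap_apply_left, Equiv.swap_apply_of_ne_of_ne hvu hvt]
          simp [hvt, hne, hadj v hvu hvt]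
    · by_cases hut : u = t
      · subst hut
        by_cases hvs : v = s
        · subst hvs; simp [hst, hts, hne']
        · by_cases hvu : v = u
          · subst hvu; simp [hvs]
          · rw [Equiv.swap_apply_right, Equiv.swap_apply_of_ne_of_ne hvs hvu]
            simp [hvs, hne', hadj v hvs hvu]
      · rw [Equiv.swap_apply_of_ne_of_ne hus hut]
        have h1 : s < u ↔ t < u := by
          rw [← not_le, ← not_le, le_iff_lt_or_eq, le_iff_lt_or_eq]
          simp [hus, hut, hadj u hus hut]
        by_cases hvs : v = s
        · subst hvs; simp [hus, hut, h1]
        · by_cases hvt : v = t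
          · subst hvt; simp [hus, hut, h1]
          · rw [Equiv.swap_apply_of_ne_of_ne hvs hvt]
            simp [hus, hut]
  simp only [sgn, Finset.prod_map, Equiv.coe_toEmbedding, key, Finset.prod_mul_distrib]
  have hprod : ∀ x y : ι, (∏ u ∈ U, ∏ v ∈ V, if u = x then if v = y then (-1 : ℤ) else 1 else 1) =
      if x ∈ U ∧ y ∈ V then -1 else 1 := by
    intro x y
    by_cases hx : x ∈ U
    · rw [Finset.prod_eq_single x (fun u _ hu => by simp [hu]) (by simp [hx])]
      simp [hx]
    · rw [Finset.prod_eq_one fun u hu => by rw [Finset.prod_eq_one]; intro v _; rw [if_neg]; rintro rfl; exact hx hu]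
      simp [hx]
  rw [hprod, hprod]

theorem map_swap_map_swap (S : Finset ι) :
    (S.map (Equiv.swap s t).toEmbedding).map (Equiv.swap s t).toEmbedding = S := by
  ext x; simp

theorem map_swap_of_mem {S : Finset ι} (hs : s ∈ S) (ht : t ∈ S) :
    S.map (Equiv.swap s t).toEmbedding = S := by
  ext x
  rw [Finset.mem_map_equiv, Equiv.symm_swap]
  by_cases h1 : x = s
  · subst h1; simp [hs, ht]
  · by_cases h2 : x = t
    · subst h2; simp [hs, ht]
    · rw [Equiv.swap_apply_of_ne_of_ne h1 h2]

/-- At a set `S` containing `s` and `t`, a term with exactly one of them in `U` cancels against the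
term of the swapped `U`, by `sgn_map_swap`; in the other terms one factor vanishes. If `S` does not
contain both, the swap changes no sign. -/
theorem Collapses.mul (hst : s < t) (hadj : ∀ x, x ≠ s → x ≠ t → (x < s ↔ x < t))
    (hf : Collapses s t f) (hg : Collapses s t g) : Collapses s t (f * g) := by
  have hsd : ∀ S U : Finset ι, (S.map (Equiv.swap s t).toEmbedding) \
      (U.map (Equiv.swap s t).toEmbedding) = (S \ U).map (Equiv.swap s t).toEmbedding :=
    fun S U => by rw [Finset.map_sdiff]
  have hz : ∀ S, s ∈ S → t ∈ S → (f * g) S = 0 := by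
    intro S hs ht
    have hS := map_swap_of_mem hs ht
    rw [mul_apply]
    refine Finset.sum_involution (fun U _ => U.map (Equiv.swap s t).toEmbedding) ?_ ?_ ?_ ?_
    · intro U hU
      have h1 := hsd S U
      rw [hS] at h1
      rw [h1, hf.map_swap, hg.map_swap, sgn_map_swap hst hadj]
      by_cases hsU : s ∈ U
      · by_cases htU : t ∈ U
        · simp [hf.eq_zero U hsU htU]
        · simp [hsU, htU, ht]
      · by_cases htU : t ∈ U
        · simp [hsU, htU, hs]
        · simp [hg.eq_zero (S \ U) (by simp [hs, hsU]) (by simp [ht, htU])]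
    · intro U hU hne h
      refine hne ?_
      have h1 : s ∈ U ↔ t ∈ U := by
        conv_lhs => rw [← h]
        rw [Finset.mem_map_equiv, Equiv.symm_swap, Equiv.swap_apply_left]
      by_cases hsU : s ∈ U
      · simp [hf.eq_zero U hsU (h1.1 hsU)]
      · simp [hg.eq_zero (S \ U) (by simp [hs, hsU]) (by simp [ht, mt h1.2 hsU])]
    · intro U hU
      rw [Finset.mem_powerset, ← hS]
      exact Finset.map_subset_map.2 (Finset.mem_powerset.1 hU)
    · intro U hU
      exact map_swap_map_swap U
  refine ⟨hz, fun S => ?_⟩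
  by_cases h : s ∈ S ∧ t ∈ S
  · rw [map_swap_of_mem h.1 h.2]
  · rw [mul_apply, mul_apply]
    refine Finset.sum_bij' (fun U _ => U.map (Equiv.swap s t).toEmbedding)
      (fun U _ => U.map (Equiv.swap s t).toEmbedding) ?_ ?_
      (fun U _ => map_swap_map_swap U) (fun U _ => map_swap_map_swap U) ?_
    · intro U hU
      rw [Finset.mem_powerset] at hU ⊢
      rw [← map_swap_map_swap (s := s) (t := t) S]
      exact Finset.map_subset_map.2 hU
    · intro U hU
      rw [Finset.mem_powerset] at hU ⊢
      exact Finset.map_subset_map.2 hU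
    · intro U hU
      have hU' : U.map (Equiv.swap s t).toEmbedding ⊆ S := by
        rw [← map_swap_map_swap (s := s) (t := t) S]
        exact Finset.map_subset_map.2 (Finset.mem_powerset.1 hU)
      have h1 := hsd S (U.map (Equiv.swap s t).toEmbedding)
      rw [map_swap_map_swap] at h1
      rw [h1, hg.map_swap, hf.map_swap]
      congr 2
      have h2 := sgn_map_swap hst hadj (U.map (Equiv.swap s t).toEmbedding)
        (S \ U.map (Equiv.swap s t).toEmbedding)
      rw [map_swap_map_swap] at h2
      rw [h2, if_neg, if_neg, one_mul, one_mul]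
      · rintro ⟨ha, hb⟩
        exact h ⟨(Finset.mem_sdiff.1 hb).1, hU' ha⟩
      · rintro ⟨ha, hb⟩
        exact h ⟨hU' ha, (Finset.mem_sdiff.1 hb).1⟩

theorem Collapses.one : Collapses s t (1 : Grassmann ι B) where
  eq_zero S hs _ := by
    rw [one_apply, if_neg]; rintro rfl; simp at hs
  map_swap S := by simp [one_apply]

theorem Collapses.pow (hst : s < t) (hadj : ∀ x, x ≠ s → x ≠ t → (x < s ↔ x < t))
    (hf : Collapses s t f) (i : ℕ) : Collapses s t (f ^ i) := by
  induction i with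
  | zero => simpa using Collapses.one
  | succ i ih => rw [_root_.pow_succ]; exact ih.mul hst hadj hf

theorem Collapses.dpow_apply_eq_zero [Fintype ι] (hst : s < t)
    (hadj : ∀ x, x ≠ s → x ≠ t → (x < s ↔ x < t)) (hf : Collapses s t f) (hn : IsHomog n f)
    (hn2 : Even n) (hn0 : 0 < n) (i : ℕ) {S : Finset ι} (hs : s ∈ S) (ht : t ∈ S) :
    dpow i f S = 0 := by
  obtain ⟨P, _, _, π, r, hr, hπ⟩ := exists_torsionFree_lift B
  have h1 : Collapses s t (mapFun r f) :=
    ⟨fun T hs ht => by simp [mapFun, hf.eq_zero T hs ht, hr],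
      fun T => by simp [mapFun, hf.map_swap T]⟩
  have h2 := (h1.pow hst hadj i).eq_zero S hs ht
  rw [← (hn.mapFun hr).factorial_smul_dpow hn2 hn0] at h2
  have h3 := (smul_eq_zero_iff_right (Nat.factorial_ne_zero i)).1 h2
  rw [← map_mapFun hπ f, ← map_dpow, map_apply, h3, _root_.map_zero]

end Vanishing

end Grassmann

/-! ### Simplicial commutative algebras -/

/-- A simplicial commutative `R`-algebra, given by its algebras of `n`-simplices and the action of
the monotone maps. -/
structure SimplicialAlg (R : Type u) [CommRing R] where
  obj : ℕ → Type u
  [commRing : ∀ n, CommRing (obj n)]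
  [algebra : ∀ n, Algebra R (obj n)]
  map : ∀ {m n : ℕ}, (Fin (m + 1) →o Fin (n + 1)) → obj n →ₐ[R] obj m
  map_id : ∀ {n : ℕ} (x : obj n), map OrderHom.id x = x
  map_comp : ∀ {l m n : ℕ} (θ : Fin (m + 1) →o Fin (n + 1)) (η : Fin (l + 1) →o Fin (m + 1))
    (x : obj n), map (θ.comp η) x = map η (map θ x)

namespace SimplicialAlg

attribute [instance] commRing algebra

/-- The monotone map `[m] → [n]` that increases at the positions in `U`, for `U` of cardinality
`n`. -/
def degenHom (n : ℕ) {m : ℕ} (U : Finset (Fin m)) : Fin (m + 1) →o Fin (n + 1) where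
  -- The minimum makes the map defined for every `U`; it has no effect when `U` has `n` elements.
  toFun x := ⟨min n (U.filter fun u : Fin m => (u : ℕ) < (x : ℕ)).card, by omega⟩
  monotone' x y hxy := by
    rw [Fin.mk_le_mk]
    refine min_le_min le_rfl (Finset.card_le_card fun a ha => ?_)
    rw [Finset.mem_filter] at ha ⊢
    exact ⟨ha.1, lt_of_lt_of_le ha.2 hxy⟩

theorem degenHom_val_eq_min (n : ℕ) {m : ℕ} (U : Finset (Fin m)) (x : Fin (m + 1)) :
    (degenHom n U x : ℕ) = min n (U.filter fun u : Fin m => (u : ℕ) < (x : ℕ)).card := rfl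

theorem degenHom_val {n m : ℕ} {U : Finset (Fin m)} (hU : U.card = n) (x : Fin (m + 1)) :
    (degenHom n U x : ℕ) = (U.filter fun u : Fin m => (u : ℕ) < (x : ℕ)).card := by
  have := Finset.card_filter_le U fun u : Fin m => (u : ℕ) < (x : ℕ)
  rw [degenHom_val_eq_min]
  omega

/-- The coface map that misses `j`. -/
def coface {n : ℕ} (j : Fin (n + 2)) : Fin (n + 1) →o Fin (n + 2) :=
  (Fin.succAboveOrderEmb j).toOrderHom

theorem coface_apply {n : ℕ} (j : Fin (n + 2)) (x : Fin (n + 1)) : coface j x = j.succAbove x := rfl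

theorem degenHom_univ (n : ℕ) : degenHom n (Finset.univ : Finset (Fin n)) = OrderHom.id := by
  ext x
  rw [degenHom_val (by simp)]
  simp only [OrderHom.id_coe, id_eq]
  have h : (x : ℕ) ≤ n := Nat.lt_succ_iff.1 x.2
  conv_rhs => rw [← min_eq_right h]
  exact Fin.card_filter_val_lt

/-- The indices of the elements of `S` below `x` form an initial segment; its cardinality is
compared with those of `Iic u` and `Iio u`. -/
theorem orderEmbOfFin_lt_iff {m : ℕ} (S : Finset (Fin m)) (u : Fin S.card) (x : ℕ) :
    (S.orderEmbOfFin rfl u : ℕ) < x ↔ (u : ℕ) < (S.filter fun s : Fin m => (s : ℕ) < x).card := by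
  have hS : (S.filter fun s : Fin m => (s : ℕ) < x).card =
      (Finset.univ.filter fun v : Fin S.card => (S.orderEmbOfFin rfl v : ℕ) < x).card := by
    rw [← Finset.card_map (S.orderEmbOfFin rfl).toEmbedding]
    congr 1
    ext y
    simp only [Finset.mem_filter, Finset.mem_map, Finset.mem_univ, true_and]
    constructor
    · rintro ⟨hy, hlt⟩
      rw [← Finset.mem_coe, ← Finset.range_orderEmbOfFin S rfl] at hy
      obtain ⟨v, rfl⟩ := hy
      exact ⟨v, hlt, rfl⟩
    · rintro ⟨v, hlt, rfl⟩
      exact ⟨Finset.orderEmbOfFin_mem S rfl v, hlt⟩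
  rw [hS]
  constructor
  · intro h
    have h1 : (Finset.Iic u).card ≤
        (Finset.univ.filter fun v : Fin S.card => (S.orderEmbOfFin rfl v : ℕ) < x).card := by
      refine Finset.card_le_card fun v hv => ?_
      simp only [Finset.mem_filter, Finset.mem_univ, true_and]
      exact lt_of_le_of_lt ((S.orderEmbOfFin rfl).monotone (Finset.mem_Iic.1 hv)) h
    rw [Fin.card_Iic] at h1
    omega
  · intro h
    by_contra hx
    have h1 : (Finset.univ.filter fun v : Fin S.card => (S.orderEmbOfFin rfl v : ℕ) < x).card ≤
        (Finset.Iio u).card := by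
      refine Finset.card_le_card fun v hv => ?_
      simp only [Finset.mem_filter, Finset.mem_univ, true_and] at hv
      rw [Finset.mem_Iio]
      exact (S.orderEmbOfFin rfl).lt_iff_lt.1
        (lt_of_lt_of_le hv (not_lt.1 hx) : (S.orderEmbOfFin rfl v : ℕ) < _)
    rw [Fin.card_Iio] at h1
    omega

/-- Choosing positions inside `S` amounts to composing degeneracies. This makes `comps a` a
compatible family. -/
theorem degenHom_map_orderEmbOfFin (n : ℕ) {m : ℕ} (S : Finset (Fin m)) (U : Finset (Fin S.card)) :
    degenHom n (U.map (S.orderEmbOfFin rfl).toEmbedding) =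
      (degenHom n U).comp (degenHom S.card S) := by
  ext x
  simp only [OrderHom.comp_coe, Function.comp_apply]
  rw [degenHom_val_eq_min, degenHom_val_eq_min, degenHom_val rfl, Finset.filter_map,
    Finset.card_map]
  congr 3
  ext u
  exact orderEmbOfFin_lt_iff S u x

variable {R : Type u} [CommRing R] (A : SimplicialAlg R)

section Components

variable {A} {n m p q r : ℕ}

/-- The degeneracies of an `n`-simplex `a` in degree `m`, as the coefficients of a homogeneous
element of degree `n` of the Grassmann algebra on `m` generators. -/
def comps (a : A.obj n) (m : ℕ) : Grassmann (Fin m) (A.obj m) :=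
  fun U => if U.card = n then A.map (degenHom n U) a else 0

theorem comps_apply {U : Finset (Fin m)} (hU : U.card = n) (a : A.obj n) :
    comps a m U = A.map (degenHom n U) a := if_pos hU

theorem isHomog_comps (a : A.obj n) (m : ℕ) : (comps a m).IsHomog n := fun _ hS => if_neg hS

theorem comps_univ (a : A.obj n) : comps a n Finset.univ = a := by
  rw [comps_apply (by simp), degenHom_univ, A.map_id]

theorem comps_add (a b : A.obj n) (m : ℕ) : comps (a + b) m = comps a m + comps b m := by
  ext S
  by_cases h : S.card = n <;> simp [comps, h]

theorem comps_smul (c : R) (a : A.obj n) (m : ℕ) : comps (c • a) m = c • comps a m := by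
  ext S
  by_cases h : S.card = n <;> simp [comps, h]

theorem comps_zero (n m : ℕ) : comps (0 : A.obj n) m = 0 := by
  ext S; simp [comps]

theorem comps_one (m : ℕ) : comps (1 : A.obj 0) m = 1 := by
  ext S
  simp [comps, Grassmann.one_apply]

/-- Families of elements of Grassmann algebras that are determined by their top coefficients. -/
def IsCompatible (F : ∀ m, Grassmann (Fin m) (A.obj m)) : Prop :=
  ∀ (m : ℕ) (S : Finset (Fin m)), Grassmann.comap (S.orderEmbOfFin rfl) (F m) =
    Grassmann.map (A.map (degenHom S.card S) : A.obj S.card →+* A.obj m) (F S.card)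

theorem isCompatible_comps (a : A.obj n) : IsCompatible (comps a) := by
  intro m S
  ext U
  rw [Grassmann.comap_apply, Grassmann.map_apply]
  by_cases h : U.card = n
  · rw [comps_apply h, comps_apply (by simpa using h), degenHom_map_orderEmbOfFin, A.map_comp]
    rfl
  · rw [isHomog_comps a _ _ h, isHomog_comps a _ _ (by simpa using h), map_zero]

theorem IsCompatible.mul {F G : ∀ m, Grassmann (Fin m) (A.obj m)} (hF : IsCompatible F)
    (hG : IsCompatible G) : IsCompatible (fun m => F m * G m) := by
  intro m S
  simp only [map_mul, hF m S, hG m S]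

theorem IsCompatible.dpow {F : ∀ m, Grassmann (Fin m) (A.obj m)} (hF : IsCompatible F)
    (hn : ∀ m, (F m).IsHomog n) (hn2 : Even n) (hn0 : 0 < n) (i : ℕ) :
    IsCompatible (fun m => (F m).dpow i) := by
  intro m S
  simp only [(hn m).comap_dpow hn2 hn0, Grassmann.map_dpow, hF m S]

/-- Compatibility at `S`, read at the top coefficient, says that the coefficient of `F m` at `S` is
a degeneracy of the top coefficient of `F S.card`. Thus operations can be iterated on Grassmann
elements without returning to simplices. -/
theorem comps_eq_of_isCompatible {F : ∀ m, Grassmann (Fin m) (A.obj m)} (hF : IsCompatible F)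
    (hn : ∀ m, (F m).IsHomog n) (m : ℕ) : comps (F n Finset.univ) m = F m := by
  ext S
  by_cases h : S.card = n
  · subst h
    have h1 := congrFun (hF m S) Finset.univ
    rw [Grassmann.comap_apply, Grassmann.map_apply] at h1
    rw [comps_apply rfl]
    refine h1.symm.trans (congrArg (F m) ?_)
    rw [← Finset.coe_inj]
    simp
  · rw [isHomog_comps _ _ _ h, hn m S h]

theorem comps_mul_univ (a : A.obj p) (b : A.obj q) (h : p + q = r) (m : ℕ) :
    comps ((comps a r * comps b r) Finset.univ) m = comps a m * comps b m :=
  comps_eq_of_isCompatible ((isCompatible_comps a).mul (isCompatible_comps b))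
    (fun m => h ▸ (isHomog_comps a m).mul (isHomog_comps b m)) m

theorem comps_dpow_univ (a : A.obj n) (hn : Even n) (hn0 : 0 < n) (i m : ℕ) :
    comps ((comps a (n * i)).dpow i Finset.univ) m = (comps a m).dpow i :=
  comps_eq_of_isCompatible ((isCompatible_comps a).dpow (isHomog_comps a) hn hn0 i)
    (fun m => (isHomog_comps a m).dpow hn hn0 i) m

end Components

/-! ### Normalized simplices -/

section Normal

variable {A} {n m p q r : ℕ}

/-- A simplex is normalized if all faces opposite to vertices different from `0` vanish. -/
def IsNormal (a : A.obj n) : Prop :=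
  ∀ ⦃m : ℕ⦄ (θ : Fin (m + 1) →o Fin (n + 1)) (j : Fin (n + 1)), j ≠ 0 → (∀ x, θ x ≠ j) →
    A.map θ a = 0

theorem isNormal_zero (a : A.obj 0) : IsNormal a :=
  fun _ _ j hj => absurd (Fin.ext (by omega)) hj

/-- A monotone map that misses the vertex `k.succ` factors through the corresponding coface. -/
theorem isNormal_succ_iff {a : A.obj (n + 1)} :
    IsNormal a ↔ ∀ k : Fin (n + 1), A.map (coface k.succ) a = 0 := by
  constructor
  · intro h k
    exact h _ k.succ (Fin.succ_ne_zero k) fun x => Fin.succAbove_ne _ _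
  · intro h m θ j hj hθ
    obtain ⟨k, rfl⟩ := Fin.exists_succ_eq.2 hj
    have : θ = (coface k.succ).comp
        ((⟨k.predAbove, Fin.predAbove_right_monotone k⟩ : Fin (n + 2) →o Fin (n + 1)).comp θ) := by
      ext x
      simp only [OrderHom.comp_coe, Function.comp_apply, OrderHom.coe_mk, coface_apply]
      rw [Fin.succ_succAbove_predAbove (hθ x)]
    rw [this, A.map_comp, h, map_zero]

/-- If `S` contains the last position, the degeneracy reaches the vertex `n` only at `m + 1`. The
last coface omits that point, so the composite misses `n`, a nonzero vertex. -/
theorem IsNormal.avoids {a : A.obj n} (ha : IsNormal a) (m : ℕ) :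
    (Grassmann.map (A.map (coface (Fin.last (m + 1))) : A.obj (m + 1) →+* A.obj m)
      (comps a (m + 1))).Avoids (Fin.last m) := by
  intro S hS
  rw [Grassmann.map_apply]
  by_cases h : S.card = n
  · rw [comps_apply h]
    refine (A.map_comp _ _ a).symm.trans (ha _ (Fin.last n) ?_ fun x hx => ?_)
    · have := Finset.card_pos.2 ⟨_, hS⟩
      rw [Ne, Fin.ext_iff, Fin.val_last, Fin.val_zero]
      omega
    · have h1 := congrArg Fin.val hx
      simp only [OrderHom.comp_coe, Function.comp_apply] at h1
      rw [degenHom_val h, coface_apply, Fin.succAbove_last, Fin.val_last, ← h] at h1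
      have h2 := Finset.card_filter_eq_iff.1 h1 _ hS
      simp only [Fin.val_last, Fin.val_castSucc] at h2
      omega
  · rw [isHomog_comps _ _ _ h, map_zero]

/-- The deleted point is `t = s + 1`. If `S` contains both positions, the value of the degeneracy at
`t` is taken nowhere else and is nonzero because `s` counts towards it, so normality applies.
Exchanging `s` and `t` in `S` can affect the degeneracy only at the deleted point. -/
theorem IsNormal.collapses {a : A.obj n} (ha : IsNormal a) {s t : Fin (m + 1)} {j : Fin (m + 2)}
    (hst : (t : ℕ) = s + 1) (hj : (j : ℕ) = t) :
    (Grassmann.map (A.map (coface j) : A.obj (m + 1) →+* A.obj m)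
      (comps a (m + 1))).Collapses s t := by
  have hlt : s < t := by rw [Fin.lt_def]; omega
  constructor
  · intro S hs ht
    rw [Grassmann.map_apply]
    by_cases h : S.card = n
    · rw [comps_apply h]
      have hc : (S.filter fun u : Fin (m + 1) => (u : ℕ) < t).card < n := by
        rw [← h]
        refine Finset.card_lt_card (Finset.filter_ssubset.2 ⟨t, ht, by simp⟩)
      refine (A.map_comp _ _ a).symm.trans
        (ha _ ⟨(S.filter fun u : Fin (m + 1) => (u : ℕ) < t).card, by omega⟩ ?_ fun x hx => ?_)
      · have : 0 < (S.filter fun u : Fin (m + 1) => (u : ℕ) < t).card :=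
          Finset.card_pos.2 ⟨s, Finset.mem_filter.2 ⟨hs, by omega⟩⟩
        rw [Ne, Fin.ext_iff]
        simp only [Fin.val_zero]
        omega
      · have h1 := congrArg Fin.val hx
        simp only [OrderHom.comp_coe, Function.comp_apply] at h1
        rw [degenHom_val h] at h1
        have hne : (coface j x : ℕ) ≠ t := fun h => Fin.succAbove_ne j x (Fin.ext (h.trans hj.symm))
        rcases lt_or_gt_of_ne hne with h2 | h2
        · refine h1.not_lt (Finset.card_lt_card ⟨fun u hu => ?_, fun hsub => ?_⟩)
          · rw [Finset.mem_filter] at hu ⊢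
            exact ⟨hu.1, by omega⟩
          · have := hsub (Finset.mem_filter.2 ⟨hs, (by omega : (s : ℕ) < t)⟩)
            rw [Finset.mem_filter] at this
            omega
        · refine h1.symm.not_lt (Finset.card_lt_card ⟨fun u hu => ?_, fun hsub => ?_⟩)
          · rw [Finset.mem_filter] at hu ⊢
            exact ⟨hu.1, by omega⟩
          · have := hsub (Finset.mem_filter.2 ⟨ht, h2⟩)
            rw [Finset.mem_filter] at this
            omega
    · rw [isHomog_comps _ _ _ h, map_zero]
  · intro S
    rw [Grassmann.map_apply, Grassmann.map_apply]
    by_cases h : S.card = n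
    · have h' : (S.map (Equiv.swap s t).toEmbedding).card = n := by simpa using h
      rw [comps_apply h, comps_apply h']
      refine (A.map_comp _ _ a).symm.trans (Eq.trans ?_ (A.map_comp _ _ a))
      congr 2
      ext x
      simp only [OrderHom.comp_coe, Function.comp_apply]
      rw [degenHom_val h, degenHom_val h', Finset.filter_map, Finset.card_map]
      congr 2
      ext u
      have hne : (coface j x : ℕ) ≠ t := fun h => Fin.succAbove_ne j x (Fin.ext (h.trans hj.symm))
      simp only [Function.comp_apply, Equiv.coe_toEmbedding]
      by_cases hus : u = s
      · subst hus; rw [Equiv.swap_apply_left]; omega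
      · by_cases hut : u = t
        · subst hut; rw [Equiv.swap_apply_right]; omega
        · rw [Equiv.swap_apply_of_ne_of_ne hus hut]
    · rw [isHomog_comps _ _ _ h, isHomog_comps _ _ _ (by simpa using h)]

theorem adjacent_of_val_eq {s t : Fin m} (hst : (t : ℕ) = s + 1) (x : Fin m) (hs : x ≠ s)
    (_ : x ≠ t) : x < s ↔ x < t := by
  rw [Fin.lt_def, Fin.lt_def]
  have := Fin.val_ne_of_ne hs
  omega

/-- The last face leaves a product without the last generator. The face of index `k + 1 ≤ r` leaves
a product in which the generators `k` and `k + 1` are merged. In both cases there is no top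
coefficient. -/
theorem IsNormal.mul {a : A.obj p} {b : A.obj q} (ha : IsNormal a) (hb : IsNormal b) :
    IsNormal ((comps a r * comps b r) Finset.univ) := by
  cases r with
  | zero => exact isNormal_zero _
  | succ r =>
    refine isNormal_succ_iff.2 fun k => ?_
    change Grassmann.map (A.map (coface k.succ) : A.obj (r + 1) →+* A.obj r)
      (comps a (r + 1) * comps b (r + 1)) Finset.univ = 0
    rw [map_mul]
    by_cases hk : (k : ℕ) = r
    · obtain rfl : k = Fin.last r := Fin.ext hk
      exact (ha.avoids r).mul (hb.avoids r) _ (Finset.mem_univ _)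
    · have hlt : (k : ℕ) + 1 < r + 1 := by have := k.2; omega
      have hst : k < ⟨k + 1, hlt⟩ := by rw [Fin.lt_def]; simp
      exact ((ha.collapses (s := k) (t := ⟨k + 1, hlt⟩) rfl rfl).mul hst
        (adjacent_of_val_eq rfl) (hb.collapses rfl rfl)).eq_zero _ (Finset.mem_univ _)
        (Finset.mem_univ _)

theorem IsNormal.dpow {a : A.obj n} (ha : IsNormal a) (hn : Even n) (hn0 : 0 < n) (i : ℕ) :
    IsNormal ((comps a (n * i)).dpow i Finset.univ) := by
  cases i with
  | zero => exact isNormal_zero _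
  | succ i =>
    obtain ⟨r, hr⟩ : ∃ r, n * (i + 1) = r + 1 :=
      Nat.exists_eq_succ_of_ne_zero (Nat.mul_pos hn0 i.succ_pos).ne'
    rw [hr]
    refine isNormal_succ_iff.2 fun k => ?_
    change Grassmann.map (A.map (coface k.succ) : A.obj (r + 1) →+* A.obj r)
      (Grassmann.dpow (i + 1) (comps a (r + 1))) Finset.univ = 0
    rw [Grassmann.map_dpow]
    have hh := (isHomog_comps a (r + 1)).map (A.map (coface k.succ) : A.obj (r + 1) →+* A.obj r)
    by_cases hk : (k : ℕ) = r
    · obtain rfl : k = Fin.last r := Fin.ext hk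
      exact (ha.avoids r).dpow_succ hh hn hn0 i _ (Finset.mem_univ _)
    · have hlt : (k : ℕ) + 1 < r + 1 := by have := k.2; omega
      have hst : k < ⟨k + 1, hlt⟩ := by rw [Fin.lt_def]; simp
      exact (ha.collapses (s := k) (t := ⟨k + 1, hlt⟩) rfl rfl).dpow_apply_eq_zero hst
        (adjacent_of_val_eq rfl) hh hn hn0 _ (Finset.mem_univ _) (Finset.mem_univ _)

end Normal

/-! ### The face opposite to the initial vertex -/

section FaceZero

variable {A} {n m : ℕ}

/-- Without the position `0`, the degeneracy is constant on the vertices `0` and `1`, and the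
identity `d_0 s_0 = id` applies. -/
theorem res_map_coface_zero (a : A.obj n) (m : ℕ) :
    Grassmann.res (Grassmann.map (A.map (coface (0 : Fin (m + 2))) : A.obj (m + 1) →+* A.obj m)
      (comps a (m + 1))) = comps a m := by
  ext T
  rw [Grassmann.res_apply, Grassmann.map_apply]
  by_cases h : T.card = n
  · have h' : (T.map (Fin.succEmb m)).card = n := by simpa using h
    rw [comps_apply h, comps_apply h']
    refine (A.map_comp _ _ a).symm.trans ?_
    congr 2
    ext x
    simp only [OrderHom.comp_coe, Function.comp_apply]
    rw [degenHom_val h, degenHom_val h', Finset.filter_map, Finset.card_map]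
    congr 2
    ext u
    simp only [Function.comp_apply, coface_apply, Fin.succAbove_zero, Fin.val_succ,
      Fin.coe_succEmb]
    omega
  · rw [isHomog_comps _ _ _ h, isHomog_comps _ _ _ (by simpa using h), map_zero]

/-- With the position `0`, the degeneracy increases from `0` to `1`; deleting the source vertex `0`
makes it miss the target vertex `0`, and it factors through that coface. -/
theorem contr_map_coface_zero (a : A.obj (n + 1)) (m : ℕ) :
    Grassmann.contr (Grassmann.map (A.map (coface (0 : Fin (m + 2))) : A.obj (m + 1) →+* A.obj m)
      (comps a (m + 1))) = comps (A.map (coface 0) a) m := by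
  ext T
  rw [Grassmann.contr, Grassmann.map_apply]
  have hc : (insert 0 (T.map (Fin.succEmb m))).card = T.card + 1 := by
    rw [Finset.card_insert_of_notMem (Grassmann.zero_notMem_map_succ T), Finset.card_map]
  by_cases h : T.card = n
  · have h' := hc.trans (congrArg (· + 1) h)
    rw [comps_apply h, comps_apply h']
    refine (A.map_comp _ _ a).symm.trans (Eq.trans ?_ (A.map_comp _ _ a))
    congr 2
    ext x
    simp only [OrderHom.comp_coe, Function.comp_apply, coface_apply, Fin.succAbove_zero,
      Fin.val_succ]
    rw [degenHom_val h, degenHom_val h', Finset.filter_insert, if_pos (by simp),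
      Finset.card_insert_of_notMem, Finset.filter_map, Finset.card_map]
    · congr 3
      ext u
      simp only [Function.comp_apply, Fin.val_succ, Fin.coe_succEmb]
      omega
    · simp
  · rw [isHomog_comps _ _ _ h, isHomog_comps _ _ _ (by rw [hc]; omega), map_zero]

theorem contr_map_coface_zero_of_degree_zero (a : A.obj 0) (m : ℕ) :
    Grassmann.contr (Grassmann.map (A.map (coface (0 : Fin (m + 2))) : A.obj (m + 1) →+* A.obj m)
      (comps a (m + 1))) = 0 := by
  ext T
  rw [Grassmann.contr, Grassmann.map_apply, isHomog_comps _ _ _ (by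
    rw [Finset.card_insert_of_notMem (Grassmann.zero_notMem_map_succ T)]; omega), map_zero]
  rfl

end FaceZero

end SimplicialAlg

namespace Grassmann

/-! ### Divided powers of homogeneous elements of arbitrary degree -/

section DivPow

theorem smul_one_pow {ι R : Type*} [LinearOrder ι] [CommRing R] {B : Type*} [CommRing B]
    [Algebra R B] (c : R) (i : ℕ) :
    (c • (1 : Grassmann ι B)) ^ i = c ^ i • (1 : Grassmann ι B) := by
  induction i with
  | zero => simp
  | succ i ih => rw [pow_succ, ih, smul_mul', one_mul, smul_smul, pow_succ]

theorem IsHomog.pow_eq_zero {ι B : Type*} [LinearOrder ι] [CommRing B] {n : ℕ} {f : Grassmann ι B}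
    (hf : IsHomog n f) (hn : Odd n) {i : ℕ} (hi : 1 < i) : f ^ i = 0 := by
  obtain ⟨k, rfl⟩ := Nat.exists_eq_add_of_lt hi
  rw [show 1 + k + 1 = 2 + k by ring, pow_add, sq, hf.mul_self hn, zero_mul]

variable {ι : Type*} [LinearOrder ι] [Fintype ι] {B B' : Type u} [CommRing B] [CommRing B']

/-- The `i`-th divided power of a homogeneous element of degree `n`. In odd degrees, it is zero for
`i > 1`. -/
def divPow (n i : ℕ) (f : Grassmann ι B) : Grassmann ι B :=
  if Even n then dpow i f else if i = 0 then 1 else if i = 1 then f else 0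

variable {n p q : ℕ} {f g : Grassmann ι B}

theorem divPow_of_even (hn : Even n) (i : ℕ) (f : Grassmann ι B) : divPow n i f = dpow i f :=
  if_pos hn

@[simp] theorem divPow_zero (n : ℕ) (f : Grassmann ι B) : divPow n 0 f = 1 := by simp [divPow]

theorem divPow_of_odd (hn : Odd n) {i : ℕ} (hi : 1 < i) (f : Grassmann ι B) :
    divPow n i f = 0 := by
  rw [divPow, if_neg (Nat.not_even_iff_odd.2 hn), if_neg (by omega), if_neg (by omega)]

theorem IsHomog.divPow_one (hf : IsHomog n f) (hn0 : 0 < n) : divPow n 1 f = f := by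
  by_cases hn : Even n
  · rw [divPow_of_even hn, hf.dpow_one hn hn0]
  · simp [divPow, hn]

/-- A case distinction for divided powers in odd degrees. -/
theorem eq_zero_or_one_or_lt (i : ℕ) : i = 0 ∨ i = 1 ∨ 1 < i := by omega

protected theorem IsHomog.divPow (hf : IsHomog n f) (hn0 : 0 < n) (i : ℕ) :
    IsHomog (n * i) (divPow n i f) := by
  rcases Nat.even_or_odd n with hn | hn
  · rw [divPow_of_even hn]; exact hf.dpow hn hn0 i
  · rcases eq_zero_or_one_or_lt i with rfl | rfl | hi
    · simpa using IsHomog.one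
    · rw [hf.divPow_one hn0]; simpa using hf
    · rw [divPow_of_odd hn hi]; exact IsHomog.zero

theorem map_divPow (ψ : B →+* B') (n i : ℕ) (f : Grassmann ι B) :
    map ψ (divPow n i f) = divPow n i (map ψ f) := by
  simp only [divPow, apply_ite (map ψ), map_dpow, map_one, map_zero]

theorem IsHomog.divPow_smul (hf : IsHomog 0 f) (hg : IsHomog n g) (hn0 : 0 < n) (i : ℕ) :
    divPow n i (f * g) = f ^ i * divPow n i g := by
  rcases Nat.even_or_odd n with hn | hn
  · simp only [divPow_of_even hn]; exact hf.dpow_mul hg Even.zero hn hn0 i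
  · rcases eq_zero_or_one_or_lt i with rfl | rfl | hi
    · simp
    · rw [hg.divPow_one hn0, (show IsHomog n (f * g) by simpa using hf.mul hg).divPow_one hn0,
        pow_one]
    · rw [divPow_of_odd hn hi, divPow_of_odd hn hi, mul_zero]

theorem IsHomog.divPow_smul_left {R : Type*} [CommRing R] [Algebra R B] (hf : IsHomog n f)
    (hn0 : 0 < n) (c : R) (i : ℕ) : divPow n i (c • f) = c ^ i • divPow n i f := by
  -- A scalar acts as multiplication by the degree zero element `c • 1`.
  have h : IsHomog 0 (c • (1 : Grassmann ι B)) := fun S hS => by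
    rw [smul_apply, IsHomog.one S hS, smul_zero]
  have := h.divPow_smul hf hn0 i
  rwa [smul_mul', one_mul, smul_one_pow, smul_mul', one_mul] at this

theorem divPow_apply_zero (n : ℕ) {i : ℕ} (hi : 0 < i) : divPow n i (0 : Grassmann ι B) = 0 := by
  rcases Nat.even_or_odd n with hn | hn
  -- Zero is homogeneous of every degree, so the product rule applies to `0 * 0` with degrees `0`
  -- and `2`.
  · rw [divPow_of_even hn, ← zero_mul (0 : Grassmann ι B),
      (IsHomog.zero (n := 0)).dpow_mul (IsHomog.zero (n := 2)) Even.zero even_two two_pos,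
      zero_pow hi.ne', zero_mul, zero_mul]
  · rcases eq_zero_or_one_or_lt i with rfl | rfl | hi
    · omega
    · simp [divPow, Nat.not_even_iff_odd.2 hn]
    · rw [divPow_of_odd hn hi]

theorem IsHomog.divPow_mul_divPow (hf : IsHomog n f) (hn0 : 0 < n) (i j : ℕ) :
    Grassmann.divPow n i f * Grassmann.divPow n j f =
      (i + j).choose i • Grassmann.divPow n (i + j) f := by
  rcases Nat.even_or_odd n with hn | hn
  · simp only [divPow_of_even hn]; exact hf.dpow_mul_dpow hn hn0 i j
  · rcases eq_zero_or_one_or_lt i with rfl | rfl | hi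
    · simp
    · rcases eq_zero_or_one_or_lt j with rfl | rfl | hj
      · simp
      · rw [hf.divPow_one hn0, hf.mul_self hn, divPow_of_odd hn (by norm_num), smul_zero]
      · rw [divPow_of_odd hn hj, divPow_of_odd hn (i := 1 + j) (by omega), mul_zero, smul_zero]
    · rw [divPow_of_odd hn hi, divPow_of_odd hn (i := i + j) (by omega), zero_mul, smul_zero]

/-- For `i > 1`, only the case of two even degrees is nontrivial: an odd factor annihilates both
sides. -/
theorem IsHomog.divPow_mul_left (hf : IsHomog p f) (hg : IsHomog q g) (hp0 : 0 < p) (hq0 : 0 < q)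
    (i : ℕ) : Grassmann.divPow (p + q) i (f * g) = f ^ i * Grassmann.divPow q i g := by
  rcases eq_zero_or_one_or_lt i with rfl | rfl | hi
  · simp
  · rw [(hf.mul hg).divPow_one (by omega), hg.divPow_one hq0, pow_one]
  rcases Nat.even_or_odd p with hp | hp <;> rcases Nat.even_or_odd q with hq | hq
  · rw [divPow_of_even (hp.add hq), divPow_of_even hq, hf.dpow_mul hg hp hq hq0]
  · rw [divPow_of_odd (hp.add_odd hq) hi, divPow_of_odd hq hi, mul_zero]
  · rw [divPow_of_odd (hp.add_even hq) hi, hf.pow_eq_zero hp hi, zero_mul]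
  · rw [divPow_of_even (hp.add_odd hq), hf.pow_eq_zero hp hi, zero_mul,
      hf.dpow_mul_of_odd hg hp hq hi]

theorem IsHomog.divPow_mul_right (hf : IsHomog p f) (hg : IsHomog q g) (hp0 : 0 < p) (hq0 : 0 < q)
    (i : ℕ) : Grassmann.divPow (p + q) i (f * g) = Grassmann.divPow p i f * g ^ i := by
  rcases eq_zero_or_one_or_lt i with rfl | rfl | hi
  · simp
  · rw [(hf.mul hg).divPow_one (by omega), hf.divPow_one hp0, pow_one]
  rcases Nat.even_or_odd p with hp | hp <;> rcases Nat.even_or_odd q with hq | hq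
  · rw [divPow_of_even (hp.add hq), divPow_of_even hp, (hf.commute hg hp).eq,
      hg.dpow_mul hf hq hp hp0, ((hf.dpow hp hp0 i).commute (hg.pow i) (hp.mul_right i)).eq]
  · rw [divPow_of_odd (hp.add_odd hq) hi, hg.pow_eq_zero hq hi, mul_zero]
  · rw [divPow_of_odd (hp.add_even hq) hi, divPow_of_odd hp hi, zero_mul]
  · rw [divPow_of_even (hp.add_odd hq), hg.pow_eq_zero hq hi, mul_zero,
      hf.dpow_mul_of_odd hg hp hq hi]

theorem IsHomog.factorial_smul_divPow (hf : IsHomog n f) (hn0 : 0 < n) (i : ℕ) :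
    i ! • Grassmann.divPow n i f = f ^ i := by
  rcases Nat.even_or_odd n with hn | hn
  · rw [divPow_of_even hn, hf.factorial_smul_dpow hn hn0]
  · rcases eq_zero_or_one_or_lt i with rfl | rfl | hi
    · simp
    · simp [hf.divPow_one hn0]
    · rw [divPow_of_odd hn hi, hf.pow_eq_zero hn hi, smul_zero]

theorem IsHomog.divPow_mul (hf : IsHomog p f) (hg : IsHomog q g) (hp0 : 0 < p) (hq0 : 0 < q)
    (i : ℕ) : Grassmann.divPow (p + q) i (f * g) =
      i ! • (Grassmann.divPow p i f * Grassmann.divPow q i g) := by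
  rw [hf.divPow_mul_left hg hp0 hq0, ← hf.factorial_smul_divPow hp0, smul_mul_assoc]

theorem IsHomog.divPow_divPow (hf : IsHomog n f) (hn0 : 0 < n) (i : ℕ) {j : ℕ} (hj : 0 < j) :
    Grassmann.divPow (n * j) i (Grassmann.divPow n j f) =
      ((i * j) ! / (i ! * (j !) ^ i)) • Grassmann.divPow n (i * j) f := by
  rcases Nat.even_or_odd n with hn | hn
  · simp only [divPow_of_even hn, divPow_of_even (hn.mul_right j)]
    exact hf.dpow_dpow hn hn0 i hj
  · rcases Nat.eq_zero_or_pos i with rfl | hi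
    · simp
    · rcases eq_zero_or_one_or_lt j with rfl | rfl | hj
      · omega
      · simp [hf.divPow_one hn0, Nat.div_self (Nat.factorial_pos i)]
      · rw [divPow_of_odd hn hj, divPow_apply_zero _ hi,
          divPow_of_odd hn (hj.trans_le (Nat.le_mul_of_pos_left j hi)), smul_zero]

end DivPow

end Grassmann

namespace SimplicialAlg

variable {R : Type u} [CommRing R] {A A' : SimplicialAlg R} {n m p q r : ℕ}

/-- The `i`-th divided power of an `n`-simplex. -/
def gamma (i : ℕ) (a : A.obj n) : A.obj (n * i) :=
  (comps a (n * i)).divPow n i Finset.univ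

theorem comps_gamma (i : ℕ) (a : A.obj n) (hn0 : 0 < n) (m : ℕ) :
    comps (gamma i a) m = (comps a m).divPow n i := by
  rcases Nat.even_or_odd n with hn | hn
  · simp only [gamma, Grassmann.divPow_of_even hn, comps_dpow_univ a hn hn0]
  · refine comps_eq_of_isCompatible (F := fun m => (comps a m).divPow n i) ?_
      (fun m => (isHomog_comps a m).divPow hn0 i) m
    intro m S
    simp only [Grassmann.divPow, Nat.not_even_iff_odd.2 hn, if_false]
    split_ifs
    · simp
    · exact isCompatible_comps a m S
    · simp

theorem IsNormal.gamma {a : A.obj n} (ha : IsNormal a) (hn0 : 0 < n) (i : ℕ) :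
    IsNormal (gamma i a) := by
  rcases Nat.even_or_odd n with hn | hn
  · rw [SimplicialAlg.gamma, Grassmann.divPow_of_even hn]
    exact ha.dpow hn hn0 i
  · rcases Grassmann.eq_zero_or_one_or_lt i with rfl | rfl | hi
    · exact isNormal_zero _
    · rw [SimplicialAlg.gamma, (isHomog_comps a _).divPow_one hn0]
      -- The degree `n * 1` is not definitionally `n`, so it is generalized before substitution.
      suffices h : ∀ k, k = n → IsNormal (comps a k Finset.univ) from h _ (mul_one n)
      rintro k rfl
      rwa [comps_univ]
    · rw [SimplicialAlg.gamma, Grassmann.divPow_of_odd hn hi]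
      intro m θ j _ _
      exact map_zero _

/-- The Leibniz rule, on the level of Grassmann algebras. -/
theorem map_coface_zero_mul_univ (a : A.obj p) (b : A.obj q) (r : ℕ) :
    A.map (coface (0 : Fin (r + 2))) ((comps a (r + 1) * comps b (r + 1)) Finset.univ) =
      (Grassmann.contr (Grassmann.map (A.map (coface (0 : Fin (r + 2))) :
        A.obj (r + 1) →+* A.obj r) (comps a (r + 1))) * comps b r +
      (-1 : ℤ) ^ p • (comps a r * Grassmann.contr (Grassmann.map
        (A.map (coface (0 : Fin (r + 2))) : A.obj (r + 1) →+* A.obj r) (comps b (r + 1)))))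
        Finset.univ := by
  change Grassmann.map (A.map (coface (0 : Fin (r + 2))) : A.obj (r + 1) →+* A.obj r)
    (comps a (r + 1) * comps b (r + 1)) Finset.univ = _
  -- The top monomial contains the smallest generator, so its coefficient survives as the top
  -- coefficient of the contraction.
  refine (Grassmann.contr_apply_univ _).symm.trans ?_
  rw [map_mul, Grassmann.contr_mul ((isHomog_comps a _).map _),
    res_map_coface_zero, res_map_coface_zero]

theorem map_coface_zero_divPow_univ (a : A.obj (n + 1)) (hn : Even (n + 1)) (i r : ℕ) :
    A.map (coface (0 : Fin (r + 2)))
      ((comps a (r + 1)).divPow (n + 1) (i + 1) Finset.univ) =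
      (comps (A.map (coface (0 : Fin (n + 2))) a) r * (comps a r).divPow (n + 1) i)
        Finset.univ := by
  change Grassmann.map (A.map (coface (0 : Fin (r + 2))) : A.obj (r + 1) →+* A.obj r)
    ((comps a (r + 1)).divPow (n + 1) (i + 1)) Finset.univ = _
  refine (Grassmann.contr_apply_univ _).symm.trans ?_
  rw [Grassmann.map_divPow, Grassmann.divPow_of_even hn, Grassmann.divPow_of_even hn,
    Grassmann.contr_dpow ((isHomog_comps a _).map _) hn,
    res_map_coface_zero, contr_map_coface_zero]

/-! ### Naturality -/

section Naturality

variable (ψ : ∀ n, A.obj n →+* A'.obj n)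
  (hψ : ∀ {m n : ℕ} (θ : Fin (m + 1) →o Fin (n + 1)) (x : A.obj n),
    ψ m (A.map θ x) = A'.map θ (ψ n x))

include hψ

theorem map_comps (a : A.obj n) (m : ℕ) :
    Grassmann.map (ψ m) (comps a m) = comps (ψ n a) m := by
  ext S
  rw [Grassmann.map_apply]
  by_cases h : S.card = n
  · rw [comps_apply h, comps_apply h, hψ]
  · rw [isHomog_comps _ _ _ h, isHomog_comps _ _ _ h, map_zero]

theorem map_mul_univ (a : A.obj p) (b : A.obj q) (r : ℕ) :
    ψ r ((comps a r * comps b r) Finset.univ) =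
      (comps (ψ p a) r * comps (ψ q b) r) Finset.univ := by
  rw [← map_comps ψ hψ, ← map_comps ψ hψ, ← map_mul, Grassmann.map_apply]

theorem map_gamma (i : ℕ) (a : A.obj n) : ψ (n * i) (gamma i a) = gamma i (ψ n a) := by
  rw [gamma, gamma, ← map_comps ψ hψ, ← Grassmann.map_divPow, Grassmann.map_apply]

end Naturality

/-! ### The décalage and divided powers of boundaries -/

/-- The monotone map `[m + 1] → [n + 1]` that preserves `0` and restricts to `θ` on the other
elements. -/
def shift (θ : Fin (m + 1) →o Fin (n + 1)) : Fin (m + 1 + 1) →o Fin (n + 1 + 1) where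
  toFun := Fin.cases 0 fun x => (θ x).succ
  monotone' x y hxy := by
    induction x using Fin.cases with
    | zero => exact Fin.zero_le _
    | succ x =>
      induction y using Fin.cases with
      | zero => exact absurd hxy (by simp)
      | succ y => exact Fin.succ_le_succ_iff.2 (θ.monotone (Fin.succ_le_succ_iff.1 hxy))

@[simp] theorem shift_zero (θ : Fin (m + 1) →o Fin (n + 1)) : shift θ 0 = 0 := rfl

@[simp] theorem shift_succ (θ : Fin (m + 1) →o Fin (n + 1)) (x : Fin (m + 1)) :
    shift θ x.succ = (θ x).succ := rfl

theorem shift_coface (j : Fin (n + 2)) : shift (coface j) = coface j.succ := by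
  ext x : 2
  induction x using Fin.cases with
  | zero => simp [coface_apply]
  | succ x => simp [coface_apply]

/-- The décalage of a simplicial algebra, which forgets the face opposite to the initial vertex. -/
def dec (A : SimplicialAlg R) : SimplicialAlg R where
  obj n := A.obj (n + 1)
  map θ := A.map (shift θ)
  map_id {n} x := by
    rw [show shift (OrderHom.id : Fin (n + 1) →o Fin (n + 1)) = OrderHom.id by
      ext x : 2
      induction x using Fin.cases <;> simp, A.map_id]
  map_comp θ η x := by
    rw [← A.map_comp]
    congr 2
    ext x : 2
    induction x using Fin.cases <;> simp

/-- The divided powers of a boundary are boundaries. -/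
theorem IsNormal.exists_map_coface_zero_eq_gamma {b : A.obj (n + 1)} (hb : IsNormal b)
    (hn0 : 0 < n) {i : ℕ} (hi : 1 ≤ i) :
    ∃ b' : A.obj (n * i + 1), IsNormal b' ∧
      A.map (coface (0 : Fin (n * i + 2))) b' = SimplicialAlg.gamma i
        (A.map (coface (0 : Fin (n + 2))) b) := by
  -- The face `d_0` is a morphism of simplicial algebras from the décalage to `A`.
  have hface : ∀ {m n : ℕ} (θ : Fin (m + 1) →o Fin (n + 1)) (x : A.dec.obj n),
      A.map (coface (0 : Fin (m + 2))) (A.dec.map θ x) =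
        A.map θ (A.map (coface (0 : Fin (n + 2))) x) := by
    intro m n θ x
    refine (A.map_comp _ _ x).symm.trans (Eq.trans ?_ (A.map_comp _ _ x))
    rfl
  rcases Nat.even_or_odd n with hn | hn
  · have hbd : IsNormal (A := A.dec) b := fun m θ j _ hθ =>
      hb (shift θ) j.succ (Fin.succ_ne_zero j) fun x => by
        induction x using Fin.cases with
        | zero => exact (Fin.succ_ne_zero j).symm
        | succ x => exact fun h => hθ x (Fin.succ_injective _ h)
    have hgam : ∀ N, N = n * i →
        IsNormal (A := A.dec) ((comps (A := A.dec) b N).divPow n i Finset.univ) := by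
      rintro _ rfl
      exact hbd.gamma hn0 i
    -- In the décalage, `b` has the even degree `n`, so its divided power can be formed there;
    -- naturality along `d_0` identifies the image.
    refine ⟨SimplicialAlg.gamma (A := A.dec) i b, isNormal_succ_iff.2 ?_,
      map_gamma (A := A.dec) (A' := A)
        (fun n => (A.map (coface (0 : Fin (n + 2))) : A.obj (n + 1) →+* A.obj n)) hface i b⟩
    suffices h : ∀ N, N = n * i → ∀ k : Fin (N + 1),
        A.map (coface k.succ) ((comps (A := A.dec) b N).divPow n i Finset.univ) = 0 from h _ rfl
    intro N hN k
    cases N with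
    | zero => exact absurd hN (Nat.mul_pos hn0 hi).ne
    | succ r =>
      rw [← shift_coface]
      change A.dec.map (coface k) _ = 0
      induction k using Fin.cases with
      | zero =>
        obtain ⟨n, rfl⟩ := Nat.exists_eq_succ_of_ne_zero hn0.ne'
        obtain ⟨i, rfl⟩ := Nat.exists_eq_add_of_le' hi
        -- The zeroth face of the décalage is `d_1` of `A`. On the divided power it produces the
        -- factor `d_1 b`, which vanishes since `b` is normalized.
        refine (map_coface_zero_divPow_univ (A := A.dec) b hn i r).trans ?_
        have h0 : A.dec.map (coface (0 : Fin (n + 2))) b = 0 := by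
          change A.map (shift (coface (0 : Fin (n + 2)))) b = 0
          rw [shift_coface]
          exact isNormal_succ_iff.1 hb 0
        rw [h0, comps_zero, zero_mul]
        rfl
      | succ k => exact isNormal_succ_iff.1 (hgam _ hN) k
  · rcases Nat.lt_or_eq_of_le hi with hi | rfl
    · refine ⟨0, fun _ _ _ _ _ => map_zero _, ?_⟩
      rw [SimplicialAlg.gamma, Grassmann.divPow_of_odd hn hi, map_zero]
      rfl
    · rw [SimplicialAlg.gamma, (isHomog_comps _ _).divPow_one hn0]
      suffices h : ∀ k, k = n → ∃ b' : A.obj (k + 1), IsNormal b' ∧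
          A.map (coface (0 : Fin (k + 2))) b' =
            comps (A.map (coface (0 : Fin (n + 2))) b) k Finset.univ from h _ (mul_one n)
      rintro k rfl
      exact ⟨b, hb, (comps_univ _).symm⟩

end SimplicialAlg

namespace SimplicialAlg

/-! ### The divided power chain algebra of normalized simplices -/

variable {R : Type u} [CommRing R]

/-- An identification of a chain complex with the complex of normalized simplices of a simplicial
commutative algebra. -/
structure NormalizedChains (A : SimplicialAlg R) (K : ChainComplex (ModuleCat.{u} R) ℕ) where
  ι : ∀ n, K.X n →ₗ[R] A.obj n
  injective : ∀ n, Function.Injective (ι n)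
  isNormal : ∀ {n : ℕ} (x : K.X n), IsNormal (ι n x)
  exists_eq : ∀ {n : ℕ} (a : A.obj n), IsNormal a → ∃ x, ι n x = a
  ι_d : ∀ {n : ℕ} (x : K.X (n + 1)),
    ι n (K.d (n + 1) n x) = A.map (coface (0 : Fin (n + 2))) (ι (n + 1) x)

namespace NormalizedChains

variable {A A' : SimplicialAlg R} {K K' : ChainComplex (ModuleCat.{u} R) ℕ}
  (N : NormalizedChains A K) (N' : NormalizedChains A' K') {n m p q r : ℕ}

/-- The element of the Grassmann algebra attached to a chain. -/
def elt (x : K.X n) (m : ℕ) : Grassmann (Fin m) (A.obj m) := comps (N.ι n x) m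

theorem isHomog_elt (x : K.X n) (m : ℕ) : (N.elt x m).IsHomog n := isHomog_comps _ m

/-- The top coefficient for `m = n` is the chain itself. Identities between chains are thereby moved
to Grassmann algebras. -/
theorem ext_elt {x y : K.X n} (h : ∀ m, N.elt x m = N.elt y m) : x = y :=
  N.injective n (by rw [← comps_univ (N.ι n x), ← comps_univ (N.ι n y)]; exact congrFun (h n) _)

theorem elt_add (x y : K.X n) (m : ℕ) : N.elt (x + y) m = N.elt x m + N.elt y m := by
  rw [elt, map_add, comps_add]; rfl

theorem elt_smul (c : R) (x : K.X n) (m : ℕ) : N.elt (c • x) m = c • N.elt x m := by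
  rw [elt, map_smul, comps_smul]; rfl

theorem elt_zero (n m : ℕ) : N.elt (0 : K.X n) m = 0 := by
  rw [elt, map_zero, comps_zero]

/-- The coefficients of a chain, as an additive map. -/
def eltHom (n m : ℕ) : K.X n →+ Grassmann (Fin m) (A.obj m) where
  toFun x := N.elt x m
  map_zero' := N.elt_zero n m
  map_add' x y := N.elt_add x y m

theorem elt_zsmul (c : ℤ) (x : K.X n) (m : ℕ) : N.elt (c • x) m = c • N.elt x m :=
  map_zsmul (N.eltHom n m) c x

theorem elt_nsmul (c : ℕ) (x : K.X n) (m : ℕ) : N.elt (c • x) m = c • N.elt x m :=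
  map_nsmul (N.eltHom n m) c x

theorem elt_sum {α : Type*} (s : Finset α) (x : α → K.X n) (m : ℕ) :
    N.elt (∑ k ∈ s, x k) m = ∑ k ∈ s, N.elt (x k) m :=
  map_sum (N.eltHom n m) x s

theorem elt_XIsoOfEq {n' : ℕ} (h : n = n') (x : K.X n) (m : ℕ) :
    N.elt ((K.XIsoOfEq h).hom x) m = N.elt x m := by
  subst h
  simp [HomologicalComplex.XIsoOfEq]

/-- The chain given by a normalized simplex. -/
noncomputable def lift (a : A.obj n) (ha : IsNormal a) : K.X n := (N.exists_eq a ha).choose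

@[simp] theorem ι_lift (a : A.obj n) (ha : IsNormal a) : N.ι n (N.lift a ha) = a :=
  (N.exists_eq a ha).choose_spec

/-- The unit of the algebra of normalized chains. -/
noncomputable def one : K.X 0 := N.lift 1 (isNormal_zero _)

theorem ι_one : N.ι 0 N.one = 1 := N.ι_lift _ _

theorem elt_one (m : ℕ) : N.elt N.one m = 1 := by rw [elt, ι_one, comps_one]

/-- The shuffle product of normalized chains, in an arbitrary degree `r`. -/
noncomputable def mulFun (a : K.X p) (b : K.X q) (r : ℕ) : K.X r :=
  N.lift ((N.elt a r * N.elt b r) Finset.univ) ((N.isNormal a).mul (N.isNormal b))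

theorem ι_mulFun (a : K.X p) (b : K.X q) (r : ℕ) :
    N.ι r (N.mulFun a b r) = (N.elt a r * N.elt b r) Finset.univ := N.ι_lift _ _

/-- The shuffle product of normalized chains, as a bilinear map. -/
noncomputable def mul (p q r : ℕ) : K.X p →ₗ[R] K.X q →ₗ[R] K.X r :=
  LinearMap.mk₂ R (fun a b => N.mulFun a b r)
    (fun a a' b => N.injective r (by
      rw [map_add, ι_mulFun, ι_mulFun, ι_mulFun, elt_add, add_mul]; rfl))
    (fun c a b => N.injective r (by
      rw [map_smul, ι_mulFun, ι_mulFun, elt_smul, Grassmann.smul_mul']; rfl))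
    (fun a b b' => N.injective r (by
      rw [map_add, ι_mulFun, ι_mulFun, ι_mulFun, elt_add, mul_add]; rfl))
    (fun c a b => N.injective r (by
      rw [map_smul, ι_mulFun, ι_mulFun, elt_smul, Grassmann.mul_smul']; rfl))

theorem ι_mul (a : K.X p) (b : K.X q) :
    N.ι r (N.mul p q r a b) = (N.elt a r * N.elt b r) Finset.univ := N.ι_mulFun a b r

theorem elt_mul (h : p + q = r) (a : K.X p) (b : K.X q) (m : ℕ) :
    N.elt (N.mul p q r a b) m = N.elt a m * N.elt b m := by
  rw [elt, ι_mul]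
  exact comps_mul_univ _ _ h m

/-- The degree `(n + 1) * (i + 1)` of a divided power is a successor only propositionally; a family
`F` over all degrees allows substitution. -/
theorem ι_d_of_top (F : ∀ m, Grassmann (Fin m) (A.obj m)) {j k : ℕ} (h : j = k + 1) {x : K.X j}
    (hx : N.ι j x = F j Finset.univ) :
    N.ι k (K.d j k x) = A.map (coface (0 : Fin (k + 2))) (F (k + 1) Finset.univ) := by
  subst h
  rw [ι_d, hx]

theorem contr_elt (a : K.X (n + 1)) (m : ℕ) :
    Grassmann.contr (Grassmann.map (A.map (coface (0 : Fin (m + 2))) :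
      A.obj (m + 1) →+* A.obj m) (N.elt a (m + 1))) = N.elt (K.d (n + 1) n a) m := by
  rw [elt, elt, contr_map_coface_zero, ι_d]

theorem ι_d_mul (a : K.X p) (b : K.X q) :
    N.ι r (K.d (r + 1) r (N.mul p q (r + 1) a b)) =
      (Grassmann.contr (Grassmann.map (A.map (coface (0 : Fin (r + 2))) :
        A.obj (r + 1) →+* A.obj r) (N.elt a (r + 1))) * N.elt b r +
      (-1 : ℤ) ^ p • (N.elt a r * Grassmann.contr (Grassmann.map
        (A.map (coface (0 : Fin (r + 2))) : A.obj (r + 1) →+* A.obj r) (N.elt b (r + 1)))))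
        Finset.univ := by
  rw [ι_d, ι_mul]
  exact map_coface_zero_mul_univ _ _ r

/-- The differential graded commutative algebra of normalized chains. -/
noncomputable def dgCommAlgStruct : LargeTensor.DGCommAlgStruct R K where
  one := N.one
  mul {p q r} _ := N.mul p q r
  one_mul {q} b := N.ext_elt fun m => by
    rw [N.elt_mul (zero_add q), elt_one, one_mul]
  mul_one {p} a := N.ext_elt fun m => by
    rw [N.elt_mul (add_zero p), elt_one, _root_.mul_one]
  mul_assoc hs ht h h' a b c := N.ext_elt fun m => by
    rw [N.elt_mul h, N.elt_mul hs, N.elt_mul h', N.elt_mul ht, mul_assoc]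
  mul_comm h h' a b := N.ext_elt fun m => by
    rw [N.elt_mul h, N.elt_zsmul, N.elt_mul h', (N.isHomog_elt a m).mul_comm (N.isHomog_elt b m)]
  leibniz {p q r} h h₁ h₂ a b := N.injective r <| by
    rw [ι_d_mul, contr_elt, contr_elt, map_add, map_zsmul, ι_mul, ι_mul]
    rfl
  leibniz_zero_right {p} a b := N.injective p <| by
    rw [ι_d_mul (r := p), contr_elt, ι_mul, show N.elt b (p + 1) = comps (N.ι 0 b) (p + 1) from rfl,
      contr_map_coface_zero_of_degree_zero, mul_zero, smul_zero, add_zero]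
  leibniz_zero_left {q} a b := N.injective q <| by
    rw [ι_d_mul (r := q), contr_elt, ι_mul, show N.elt a (q + 1) = comps (N.ι 0 a) (q + 1) from rfl,
      contr_map_coface_zero_of_degree_zero, zero_mul, zero_add, pow_zero, one_smul]

theorem elt_pow (a : K.X n) (i m : ℕ) :
    N.elt (N.dgCommAlgStruct.pow a i) m = N.elt a m ^ i := by
  induction i with
  | zero => exact (N.elt_one m).trans (pow_zero _).symm
  | succ i ih =>
    refine (N.elt_mul (Nat.mul_succ n i).symm (N.dgCommAlgStruct.pow a i) a m).trans ?_
    rw [ih, pow_succ]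

/-- The divided powers of normalized chains. -/
noncomputable def divPow (i : ℕ) (hn : 0 < n) (a : K.X n) : K.X (n * i) :=
  N.lift (gamma i (N.ι n a)) ((N.isNormal a).gamma hn i)

theorem ι_divPow (i : ℕ) (hn : 0 < n) (a : K.X n) :
    N.ι (n * i) (N.divPow i hn a) = gamma i (N.ι n a) := N.ι_lift _ _

theorem elt_divPow (i : ℕ) (hn : 0 < n) (a : K.X n) (m : ℕ) :
    N.elt (N.divPow i hn a) m = (N.elt a m).divPow n i := by
  rw [elt, ι_divPow, comps_gamma i _ hn]
  rfl

/-- The divided power chain algebra of normalized chains. -/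
noncomputable def dpChainAlgStruct : LargeTensor.DPChainAlgStruct R K where
  toDGCommAlgStruct := N.dgCommAlgStruct
  gamma i _ hn a := N.divPow i hn a
  gamma_zero hn a := N.ext_elt fun m => by
    rw [elt_divPow, Grassmann.divPow_zero]
    exact (N.elt_one m).symm
  gamma_one hn a := N.ext_elt fun m => by
    rw [elt_divPow, elt_XIsoOfEq, (N.isHomog_elt a m).divPow_one hn]
  gamma_odd hn a hodd hi := N.ext_elt fun m => by
    rw [elt_divPow, Grassmann.divPow_of_odd hodd hi, elt_zero]
  gamma_smul i n hn c a := N.ext_elt fun m => by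
    rw [elt_divPow, elt_smul, elt_smul, elt_divPow, (N.isHomog_elt a m).divPow_smul_left hn]
  gamma_deg_zero_mul i n hn z a := N.ext_elt fun m => by
    rw [elt_divPow]
    refine Eq.trans ?_ (N.elt_mul (by simp) _ _ m).symm
    rw [elt_pow, elt_divPow]
    refine (congrArg _ (N.elt_mul (zero_add n) z a m)).trans ?_
    exact (N.isHomog_elt z m).divPow_smul (N.isHomog_elt a m) hn i
  gamma_mul_gamma i j n hn a := N.ext_elt fun m => by
    rw [elt_nsmul, elt_divPow]
    refine (N.elt_mul (Nat.mul_add n i j).symm _ _ m).trans ?_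
    rw [elt_divPow, elt_divPow, (N.isHomog_elt a m).divPow_mul_divPow hn]
  gamma_add i n hn hev a b := N.ext_elt fun m => by
    rw [elt_divPow, elt_sum, elt_add, Grassmann.divPow_of_even hev,
      (N.isHomog_elt a m).dpow_add (N.isHomog_elt b m) hev hn,
      ← Finset.sum_coe_sort (Finset.HasAntidiagonal.antidiagonal i)]
    refine Finset.sum_congr rfl fun k _ => ?_
    refine Eq.trans ?_ (N.elt_mul (by
      rw [← Nat.mul_add, Finset.HasAntidiagonal.mem_antidiagonal.1 k.2]) _ _ m).symm
    rw [elt_divPow, elt_divPow, Grassmann.divPow_of_even hev, Grassmann.divPow_of_even hev]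
  gamma_mul_eq_factorial i p q hp hq a b := N.ext_elt fun m => by
    rw [elt_divPow, elt_nsmul]
    refine Eq.trans ?_ (congrArg (i ! • ·) (N.elt_mul (Nat.add_mul p q i).symm _ _ m).symm)
    refine (congrArg _ (N.elt_mul rfl a b m)).trans ?_
    simp only [elt_divPow]
    exact (N.isHomog_elt a m).divPow_mul (N.isHomog_elt b m) hp hq i
  gamma_mul_eq_left i p q hp hq a b := N.ext_elt fun m => by
    rw [elt_divPow]
    refine Eq.trans ?_ (N.elt_mul (Nat.add_mul p q i).symm _ _ m).symm
    refine (congrArg _ (N.elt_mul rfl a b m)).trans ?_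
    rw [elt_divPow, elt_pow]
    exact (N.isHomog_elt a m).divPow_mul_left (N.isHomog_elt b m) hp hq i
  gamma_mul_eq_right i p q hp hq a b := N.ext_elt fun m => by
    rw [elt_divPow]
    refine Eq.trans ?_ (N.elt_mul (Nat.add_mul p q i).symm _ _ m).symm
    refine (congrArg _ (N.elt_mul rfl a b m)).trans ?_
    rw [elt_divPow, elt_pow]
    exact (N.isHomog_elt a m).divPow_mul_right (N.isHomog_elt b m) hp hq i
  gamma_gamma i j n hn hj a := N.ext_elt fun m => by
    rw [elt_divPow, elt_divPow, elt_nsmul, elt_XIsoOfEq, elt_divPow,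
      (N.isHomog_elt a m).divPow_divPow hn i hj]
  d_gamma i n hev c := N.injective _ <| by
    rw [N.ι_d_of_top (fun m => (N.elt c m).divPow (n + 1) (i + 1))
      (show (n + 1) * (i + 1) = n + (n + 1) * i + 1 by ring) (N.ι_divPow _ _ _)]
    refine Eq.trans ?_ (N.ι_mul _ _).symm
    rw [elt_divPow]
    refine (map_coface_zero_divPow_univ (N.ι _ c) hev i _).trans ?_
    rw [← ι_d]
    rfl
  gamma_boundary {i n} hn hi b := by
    obtain ⟨b', hb', h⟩ := (N.isNormal b).exists_map_coface_zero_eq_gamma hn hi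
    refine ⟨N.lift b' hb', N.injective _ ?_⟩
    rw [ι_d, ι_lift, h, ι_divPow, ι_d]

section Naturality

variable {N N'} (f : K ⟶ K') (ψ : ∀ n, A.obj n →ₐ[R] A'.obj n)
  (hψ : ∀ {m n : ℕ} (θ : Fin (m + 1) →o Fin (n + 1)) (x : A.obj n),
    ψ m (A.map θ x) = A'.map θ (ψ n x))
  (hf : ∀ {n : ℕ} (x : K.X n), N'.ι n (f.f n x) = ψ n (N.ι n x))

/-- The morphism of divided power chain algebras induced by a morphism of simplicial algebras. -/
def dpChainAlgHom : LargeTensor.DPChainAlg.Hom ⟨K, N.dpChainAlgStruct⟩ ⟨K', N'.dpChainAlgStruct⟩ where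
  toChainMap := f
  map_one := N'.injective 0 <| by
    rw [hf]
    refine (congrArg (ψ 0) N.ι_one).trans ?_
    rw [map_one]
    exact N'.ι_one.symm
  map_mul {p q r} h a b := N'.injective r <| by
    rw [hf]
    refine (congrArg (ψ r) (N.ι_mul a b)).trans ?_
    refine (map_mul_univ (fun n => (ψ n : A.obj n →+* A'.obj n)) hψ _ _ r).trans ?_
    refine Eq.trans ?_ (N'.ι_mul _ _).symm
    simp only [elt, hf]
    rfl
  map_gamma i n hn a := N'.injective _ <| by
    rw [hf]
    refine (congrArg (ψ _) (N.ι_divPow i hn a)).trans ?_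
    refine (map_gamma (fun n => (ψ n : A.obj n →+* A'.obj n)) hψ i _).trans ?_
    refine Eq.trans ?_ (N'.ι_divPow i hn _).symm
    rw [hf]
    rfl

end Naturality

end NormalizedChains

end SimplicialAlg

/-! ### Commutative monoids in simplicial modules as simplicial commutative algebras. -/

namespace SimplicialModule

variable {R : Type u} [CommRing R] {X Y : SimplicialObject (ModuleCat.{u} R)} (μ : X ⊗ X ⟶ X)
  (η : 𝟙_ (SimplicialObject (ModuleCat.{u} R)) ⟶ X)

theorem mul_comm_apply (h : (β_ X X).hom ≫ μ = μ) {n : ℕ} (x y : X _⦋n⦌) :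
    μ.app (op ⦋n⦌) (x ⊗ₜ[R] y) = μ.app (op ⦋n⦌) (y ⊗ₜ[R] x) :=
  (ConcreteCategory.congr_hom (NatTrans.congr_app h (op ⦋n⦌)) (x ⊗ₜ[R] y)).symm

theorem mul_assoc_apply (h : μ ▷ X ≫ μ = (α_ X X X).hom ≫ X ◁ μ ≫ μ) {n : ℕ} (x y z : X _⦋n⦌) :
    μ.app (op ⦋n⦌) (μ.app (op ⦋n⦌) (x ⊗ₜ[R] y) ⊗ₜ[R] z) =
      μ.app (op ⦋n⦌) (x ⊗ₜ[R] μ.app (op ⦋n⦌) (y ⊗ₜ[R] z)) :=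
  ConcreteCategory.congr_hom (NatTrans.congr_app h (op ⦋n⦌)) ((x ⊗ₜ[R] y) ⊗ₜ[R] z)

theorem one_mul_apply (h : η ▷ X ≫ μ = (λ_ X).hom) {n : ℕ} (x : X _⦋n⦌) :
    μ.app (op ⦋n⦌) (η.app (op ⦋n⦌) (1 : R) ⊗ₜ[R] x) = x :=
  (ConcreteCategory.congr_hom (NatTrans.congr_app h (op ⦋n⦌)) ((1 : R) ⊗ₜ[R] x)).trans
    (one_smul R x)

theorem mul_add_apply {n : ℕ} (x y z : X _⦋n⦌) :
    μ.app (op ⦋n⦌) (x ⊗ₜ[R] (y + z)) =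
      μ.app (op ⦋n⦌) (x ⊗ₜ[R] y) + μ.app (op ⦋n⦌) (x ⊗ₜ[R] z) :=
  (congrArg _ (TensorProduct.tmul_add x y z)).trans (map_add (μ.app (op ⦋n⦌)).hom _ _)

theorem smul_mul_apply {n : ℕ} (r : R) (x y : X _⦋n⦌) :
    μ.app (op ⦋n⦌) ((r • x) ⊗ₜ[R] y) = r • μ.app (op ⦋n⦌) (x ⊗ₜ[R] y) :=
  map_smul (μ.app (op ⦋n⦌)).hom r (x ⊗ₜ[R] y)

theorem map_mul_apply {m n : ℕ} (θ : ⦋m⦌ ⟶ ⦋n⦌) (x y : X _⦋n⦌) :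
    X.map θ.op (μ.app (op ⦋n⦌) (x ⊗ₜ[R] y)) =
      μ.app (op ⦋m⦌) (X.map θ.op x ⊗ₜ[R] X.map θ.op y) :=
  (ConcreteCategory.congr_hom (μ.naturality θ.op) (x ⊗ₜ[R] y)).symm

theorem map_one_apply {m n : ℕ} (θ : ⦋m⦌ ⟶ ⦋n⦌) :
    X.map θ.op (η.app (op ⦋n⦌) (1 : R)) = η.app (op ⦋m⦌) (1 : R) :=
  (ConcreteCategory.congr_hom (η.naturality θ.op) (1 : R)).symm

theorem app_mul_apply (μ' : Y ⊗ Y ⟶ Y) (f : X ⟶ Y) (h : μ ≫ f = (f ⊗ₘ f) ≫ μ') {n : ℕ}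
    (x y : X _⦋n⦌) : f.app (op ⦋n⦌) (μ.app (op ⦋n⦌) (x ⊗ₜ[R] y)) =
      μ'.app (op ⦋n⦌) (f.app (op ⦋n⦌) x ⊗ₜ[R] f.app (op ⦋n⦌) y) :=
  ConcreteCategory.congr_hom (NatTrans.congr_app h (op ⦋n⦌)) (x ⊗ₜ[R] y)

/-- The commutative ring of `n`-simplices of a commutative monoid in simplicial modules. -/
abbrev commRing (hc : (β_ X X).hom ≫ μ = μ)
    (ha : μ ▷ X ≫ μ = (α_ X X X).hom ≫ X ◁ μ ≫ μ) (ho : η ▷ X ≫ μ = (λ_ X).hom) (n : ℕ) :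
    CommRing (X _⦋n⦌) where
  __ := (inferInstance : AddCommGroup (X _⦋n⦌))
  mul x y := μ.app (op ⦋n⦌) (x ⊗ₜ[R] y)
  one := η.app (op ⦋n⦌) (1 : R)
  mul_comm := mul_comm_apply μ hc
  mul_assoc := mul_assoc_apply μ ha
  one_mul := one_mul_apply μ η ho
  mul_one x := (mul_comm_apply μ hc x _).trans (one_mul_apply μ η ho x)
  left_distrib := mul_add_apply μ
  right_distrib x y z := by
    refine (mul_comm_apply μ hc _ _).trans ((mul_add_apply μ z x y).trans ?_)
    rw [mul_comm_apply μ hc z x, mul_comm_apply μ hc z y]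
    rfl
  zero_mul x := by
    refine (mul_comm_apply μ hc _ _).trans ?_
    exact (congrArg _ (TensorProduct.tmul_zero _ x)).trans (map_zero (μ.app (op ⦋n⦌)).hom)
  mul_zero x :=
    (congrArg _ (TensorProduct.tmul_zero _ x)).trans (map_zero (μ.app (op ⦋n⦌)).hom)

/-- The simplicial commutative algebra given by a commutative monoid in simplicial modules. -/
def toSimplicialAlg (hc : (β_ X X).hom ≫ μ = μ)
    (ha : μ ▷ X ≫ μ = (α_ X X X).hom ≫ X ◁ μ ≫ μ) (ho : η ▷ X ≫ μ = (λ_ X).hom) :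
    SimplicialAlg R where
  obj n := X _⦋n⦌
  commRing n := commRing μ η hc ha ho n
  algebra n :=
    letI := commRing μ η hc ha ho n
    Algebra.ofModule (smul_mul_apply μ) fun r x y => by
      change μ.app (op ⦋n⦌) (x ⊗ₜ[R] (r • y)) = r • μ.app (op ⦋n⦌) (x ⊗ₜ[R] y)
      rw [mul_comm_apply μ hc, smul_mul_apply, mul_comm_apply μ hc]
  map {m n} θ :=
    letI := commRing μ η hc ha ho n
    letI := commRing μ η hc ha ho m
    letI : Algebra R (X _⦋n⦌) := Algebra.ofModule (smul_mul_apply μ) fun r x y => by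
      change μ.app (op ⦋n⦌) (x ⊗ₜ[R] (r • y)) = r • μ.app (op ⦋n⦌) (x ⊗ₜ[R] y)
      rw [mul_comm_apply μ hc, smul_mul_apply, mul_comm_apply μ hc]
    letI : Algebra R (X _⦋m⦌) := Algebra.ofModule (smul_mul_apply μ) fun r x y => by
      change μ.app (op ⦋m⦌) (x ⊗ₜ[R] (r • y)) = r • μ.app (op ⦋m⦌) (x ⊗ₜ[R] y)
      rw [mul_comm_apply μ hc, smul_mul_apply, mul_comm_apply μ hc]
    AlgHom.ofLinearMap (X.map (SimplexCategory.mkHom θ).op).hom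
      (map_one_apply η (SimplexCategory.mkHom θ)) (map_mul_apply μ (SimplexCategory.mkHom θ))
  map_id x := ConcreteCategory.congr_hom (X.map_id _) x
  map_comp θ η x :=
    ConcreteCategory.congr_hom
      (X.map_comp (SimplexCategory.mkHom θ).op (SimplexCategory.mkHom η).op) x

end SimplicialModule

/-! ### The normalized Moore complex in terms of elements. -/

section NormalizedMooreComplex

open AlgebraicTopology

variable {R : Type u} [CommRing R] (X : SimplicialObject (ModuleCat.{u} R))

namespace SimplicialModule

/-- The inclusion of normalized chains into simplices. -/
noncomputable def normalizedArrow (n : ℕ) : ((normalizedMooreComplex _).obj X).X n ⟶ X _⦋n⦌ :=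
  (NormalizedMooreComplex.objX X n).arrow

theorem normalizedArrow_injective (n : ℕ) : Function.Injective (normalizedArrow X n) :=
  (ModuleCat.mono_iff_injective _).1
    (inferInstanceAs (Mono (NormalizedMooreComplex.objX X n).arrow))

/-- The normalized part is an infimum of kernel subobjects, so its inclusion factors through each
kernel. -/
theorem δ_normalizedArrow {n : ℕ} (k : Fin (n + 1))
    (x : ((normalizedMooreComplex _).obj X).X (n + 1)) :
    X.δ k.succ (normalizedArrow X (n + 1) x) = 0 := by
  have h1 := Subobject.factorThru_arrow _ _ (Subobject.finset_inf_arrow_factors Finset.univ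
    (fun k : Fin (n + 1) => Limits.kernelSubobject (X.δ k.succ)) k (Finset.mem_univ k))
  have h : (NormalizedMooreComplex.objX X (n + 1)).arrow ≫ X.δ k.succ = 0 := by
    refine (congrArg (· ≫ X.δ k.succ) h1).symm.trans ?_
    simp only [Category.assoc, Limits.kernelSubobject_arrow_comp, Limits.comp_zero]
    rfl
  exact ConcreteCategory.congr_hom h x

theorem exists_normalizedArrow_eq {n : ℕ} (a : X _⦋n + 1⦌)
    (ha : ∀ k : Fin (n + 1), X.δ k.succ a = 0) : ∃ x, normalizedArrow X (n + 1) x = a := by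
  -- The element is regarded as a morphism from `R`, to which the universal property of the infimum
  -- of kernels applies.
  let g : ModuleCat.of R R ⟶ X _⦋n + 1⦌ := ModuleCat.ofHom (LinearMap.toSpanSingleton R _ a)
  have hg : (NormalizedMooreComplex.objX X (n + 1)).Factors g := by
    refine (Subobject.finset_inf_factors _).2 fun k _ => Limits.kernelSubobject_factors _ _ ?_
    ext
    change X.δ k.succ ((1 : R) • a) = 0
    rw [one_smul, ha]
  refine ⟨Subobject.factorThru _ g hg (1 : R), ?_⟩
  refine (ConcreteCategory.congr_hom (Subobject.factorThru_arrow _ g hg) (1 : R)).trans ?_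
  exact one_smul R a

theorem exists_normalizedArrow_eq_zero (a : X _⦋0⦌) : ∃ x, normalizedArrow X 0 x = a := by
  have : IsIso (normalizedArrow X 0) :=
    inferInstanceAs (IsIso (⊤ : Subobject (X _⦋0⦌)).arrow)
  exact ((ConcreteCategory.isIso_iff_bijective _).1 this).2 a

theorem normalizedArrow_d {n : ℕ} (x : ((normalizedMooreComplex _).obj X).X (n + 1)) :
    normalizedArrow X n (((normalizedMooreComplex _).obj X).d (n + 1) n x) =
      X.δ 0 (normalizedArrow X (n + 1) x) := by
  have h : NormalizedMooreComplex.objD X n ≫ (NormalizedMooreComplex.objX X n).arrow =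
      (NormalizedMooreComplex.objX X (n + 1)).arrow ≫ X.δ 0 := by
    cases n with
    | zero =>
      change ((NormalizedMooreComplex.objX X 1).arrow ≫ X.δ (0 : Fin 2) ≫
        inv (⊤ : Subobject _).arrow) ≫ (⊤ : Subobject _).arrow = _
      simp only [Category.assoc, IsIso.inv_hom_id, Category.comp_id]
    | succ n =>
      rw [NormalizedMooreComplex.objD]
      exact Subobject.factorThru_arrow _ _ _
  rw [normalizedMooreComplex_objD]
  exact ConcreteCategory.congr_hom h x

theorem normalizedArrow_map {X Y : SimplicialObject (ModuleCat.{u} R)} (f : X ⟶ Y) {n : ℕ}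
    (x : ((normalizedMooreComplex _).obj X).X n) :
    normalizedArrow Y n (((normalizedMooreComplex _).map f).f n x) =
      f.app (op ⦋n⦌) (normalizedArrow X n x) := by
  have h : ((normalizedMooreComplex _).map f).f n ≫ normalizedArrow Y n =
      normalizedArrow X n ≫ f.app (op ⦋n⦌) := by
    simp only [normalizedMooreComplex_map, NormalizedMooreComplex.map_f]
    exact Subobject.factorThru_arrow _ _ _
  exact ConcreteCategory.congr_hom h x

end SimplicialModule

end NormalizedMooreComplex

/-! ### The simplicial commutative algebra `ΓC` and its normalized chains. -/

namespace LargeTensor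

variable {R : Type u} [CommRing R]

/-- The simplicial module `ΓC` as a commutative monoid. -/
noncomputable def GamMon (C : ComTilde R) : CommMon (SimplicialObject (ModuleCat.{u} R)) :=
  (Monoidal.equivalenceTransported (doldKan R)).inverse.mapCommMon.obj C

/-- The inverse of the transported equivalence preserves commutative monoids, and the multiplication
it induces on `ΓC` is definitionally `muHat C`. The other monoid axioms follow in the same way. -/
theorem muHat_comm (C : ComTilde R) : (β_ ((Gam R).obj C) ((Gam R).obj C)).hom ≫ muHat C = muHat C :=
  IsCommMonObj.mul_comm (GamMon C).X

theorem muHat_assoc (C : ComTilde R) : muHat C ▷ (Gam R).obj C ≫ muHat C =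
    (α_ ((Gam R).obj C) ((Gam R).obj C) ((Gam R).obj C)).hom ≫ (Gam R).obj C ◁ muHat C ≫ muHat C :=
  MonObj.mul_assoc (GamMon C).X

theorem etaHat_muHat (C : ComTilde R) :
    etaHat C ▷ (Gam R).obj C ≫ muHat C = (λ_ ((Gam R).obj C)).hom :=
  MonObj.one_mul (GamMon C).X

theorem muHat_naturality {C C' : ComTilde R} (f : C ⟶ C') :
    muHat C ≫ (Gam R).map f = ((Gam R).map f ⊗ₘ (Gam R).map f) ≫ muHat C' :=
  IsMonHom.mul_hom (((Monoidal.equivalenceTransported (doldKan R)).inverse.mapCommMon.map f).hom.hom)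

theorem etaHat_naturality {C C' : ComTilde R} (f : C ⟶ C') :
    etaHat C ≫ (Gam R).map f = etaHat C' :=
  IsMonHom.one_hom (((Monoidal.equivalenceTransported (doldKan R)).inverse.mapCommMon.map f).hom.hom)

/-- The simplicial commutative algebra `ΓC`. -/
noncomputable def GamAlg (C : ComTilde R) : SimplicialAlg R :=
  SimplicialModule.toSimplicialAlg (muHat C) (etaHat C) (muHat_comm C) (muHat_assoc C)
    (etaHat_muHat C)

theorem isNormal_GamAlg_iff (C : ComTilde R) {n : ℕ} (a : (Gam R).obj C _⦋n + 1⦌) :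
    SimplicialAlg.IsNormal (A := GamAlg C) (n := n + 1) a ↔
      ∀ k : Fin (n + 1), ((Gam R).obj C).δ k.succ a = 0 :=
  SimplicialAlg.isNormal_succ_iff (A := GamAlg C)

/-- The chains of `NΓC` are the normalized simplices of `ΓC`. -/
noncomputable def normalizedChains (C : ComTilde R) :
    (GamAlg C).NormalizedChains ((NGam R).obj C) where
  ι n := (incl C n).hom
  injective n := SimplicialModule.normalizedArrow_injective ((Gam R).obj C) n
  isNormal {n} x := by
    cases n with
    | zero => exact SimplicialAlg.isNormal_zero _
    | succ n =>
      exact (isNormal_GamAlg_iff C _).2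
        fun k => SimplicialModule.δ_normalizedArrow ((Gam R).obj C) k x
  exists_eq {n} a ha := by
    cases n with
    | zero => exact SimplicialModule.exists_normalizedArrow_eq_zero ((Gam R).obj C) a
    | succ n =>
      exact SimplicialModule.exists_normalizedArrow_eq ((Gam R).obj C) a
        ((isNormal_GamAlg_iff C _).1 ha)
  ι_d x := SimplicialModule.normalizedArrow_d ((Gam R).obj C) x

end LargeTensor

namespace Grassmann

/-! ### Shuffles -/

section Sign

/-- The sign counts inversions, and only pairs in `r` can be inverted. For shuffles, `r` says that
the first position lies in an earlier block than the second. -/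
theorem sign_eq_prod_ite {m : ℕ} (σ : Equiv.Perm (Fin m)) (r : Fin m → Fin m → Prop)
    [∀ i j, Decidable (r i j)] (hr : ∀ i j, r i j → i < j)
    (hσ : ∀ i j, i < j → ¬ r i j → σ i < σ j) :
    (Equiv.Perm.sign σ : ℤ) =
      ∏ j, ∏ i, if r i j then (if σ j < σ i then -1 else 1) else 1 := by
  rw [Equiv.Perm.sign_eq_prod_prod_Iio]
  push_cast
  refine Finset.prod_congr rfl fun j _ => ?_
  refine Finset.prod_subset_one_on_sdiff (Finset.subset_univ _) ?_ ?_
  · intro i hi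
    rw [if_neg]
    intro h
    simp at hi
    exact (hr i j h).not_ge hi
  · intro i hi
    have hij := Finset.mem_Iio.1 hi
    by_cases h : r i j
    · rw [if_pos h]
      rcases lt_trichotomy (σ i) (σ j) with h1 | h1 | h1
      · simp [h1, h1.not_gt]
      · exact absurd (σ.injective h1) hij.ne
      · simp [h1, h1.not_gt]
    · rw [if_neg h, if_pos (hσ i j hij h)]
      rfl

variable {ι α β : Type*} [LinearOrder ι] [Fintype α] [Fintype β]

theorem sgn_image {f : α → ι} {g : β → ι} (hf : Function.Injective f) (hg : Function.Injective g) :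
    sgn (Finset.univ.image f) (Finset.univ.image g) =
      ∏ a, ∏ b, if g b < f a then -1 else 1 := by
  rw [sgn, Finset.prod_image fun _ _ _ _ h => hf h]
  exact Finset.prod_congr rfl fun a _ => Finset.prod_image fun _ _ _ _ h => hg h

end Sign

theorem _root_.Finset.strictMono_ext {n : ℕ} {α : Type*} [LinearOrder α] {f g : Fin n → α}
    (hf : StrictMono f) (hg : StrictMono g)
    (h : Finset.univ.image f = Finset.univ.image g) : f = g := by
  have hc : (Finset.univ.image f).card = n := by
    rw [Finset.card_image_of_injective _ hf.injective, Finset.card_univ, Fintype.card_fin]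
  exact (Finset.orderEmbOfFin_unique hc (fun x => Finset.mem_image_of_mem f (Finset.mem_univ x))
    hf).trans (Finset.orderEmbOfFin_unique hc
      (fun x => h ▸ Finset.mem_image_of_mem g (Finset.mem_univ x)) hg).symm

/-! ### Top coefficients of products as sums over `(p, q)`-shuffles. -/

section TwoBlocks

variable {p q : ℕ} {B : Type u} [CommRing B]

theorem image_castAdd_compl (σ : Equiv.Perm (Fin (p + q))) :
    Finset.univ \ Finset.univ.image (fun a : Fin p => σ (Fin.castAdd q a)) =
      Finset.univ.image (fun b : Fin q => σ (Fin.natAdd p b)) := by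
  ext x
  obtain ⟨y, rfl⟩ := σ.surjective x
  induction y using Fin.addCases with
  | left a =>
    simp only [Finset.mem_sdiff, Finset.mem_univ, true_and, Finset.mem_image,
      EmbeddingLike.apply_eq_iff_eq]
    constructor
    · intro h; exact absurd ⟨a, rfl⟩ h
    · rintro ⟨b, hb⟩
      have := congrArg Fin.val hb
      simp at this
      omega
  | right b =>
    simp only [Finset.mem_sdiff, Finset.mem_univ, true_and, Finset.mem_image,
      EmbeddingLike.apply_eq_iff_eq]
    constructor
    · intro _; exact ⟨b, rfl⟩
    · rintro _ ⟨a, ha⟩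
      have := congrArg Fin.val ha
      simp at this
      omega

theorem sign_shuffle {σ : Equiv.Perm (Fin (p + q))} (hσ : LargeTensor.IsShuffle p q σ) :
    (Equiv.Perm.sign σ : ℤ) =
      sgn (Finset.univ.image fun a : Fin p => σ (Fin.castAdd q a))
        (Finset.univ.image fun b : Fin q => σ (Fin.natAdd p b)) := by
  rw [sgn_image hσ.1.injective hσ.2.injective,
    sign_eq_prod_ite σ (fun i j => (i : ℕ) < p ∧ p ≤ (j : ℕ))
      (fun i j h => Fin.lt_def.2 (h.1.trans_le h.2)), Finset.prod_comm (s := Finset.univ)]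
  · have hp : ∀ a : Fin p, ¬ p ≤ (a : ℕ) := fun a => not_le.2 a.2
    simp [Fin.prod_univ_add, hp]
  · intro i j hij h
    induction i using Fin.addCases with
    | left a =>
      induction j using Fin.addCases with
      | left b => exact hσ.1 (Fin.lt_def.2 (Fin.lt_def.1 hij))
      | right b => exact absurd ⟨by simp, by simp⟩ h
    | right a =>
      induction j using Fin.addCases with
      | left b =>
        rw [Fin.lt_def, Fin.val_natAdd, Fin.val_castAdd] at hij
        omega
      | right b => exact hσ.2 (by simpa using hij)

/-- A shuffle is determined by the image of its first block, an arbitrary `p`-element set; sets of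
other cardinalities contribute nothing by homogeneity. -/
theorem mul_apply_univ_eq_sum_shuffles {f g : Grassmann (Fin (p + q)) B} (hf : f.IsHomog p) :
    (f * g) Finset.univ = ∑ σ : Equiv.Perm (Fin (p + q)) with LargeTensor.IsShuffle p q σ,
      (Equiv.Perm.sign σ : ℤ) • (f (Finset.univ.image fun a : Fin p => σ (Fin.castAdd q a)) *
        g (Finset.univ.image fun b : Fin q => σ (Fin.natAdd p b))) := by
  rw [mul_apply]
  symm
  refine Finset.sum_of_injOn
    (fun σ => Finset.univ.image fun a : Fin p => σ (Fin.castAdd q a)) ?_ (by simp [Set.MapsTo]) ?_ ?_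
  · intro σ hσ τ hτ h
    simp only [Finset.coe_filter, Finset.mem_univ, true_and, Set.mem_ofPred_eq] at hσ hτ h
    have h2 := image_castAdd_compl σ
    rw [h, image_castAdd_compl τ] at h2
    have e1 := Finset.strictMono_ext hσ.1 hτ.1 h
    have e2 := Finset.strictMono_ext hτ.2 hσ.2 h2
    ext x : 1
    induction x using Fin.addCases with
    | left a => exact congrFun e1 a
    | right b => exact (congrFun e2 b).symm
  · intro U _ hU
    rw [hf U, zero_mul, mul_zero]
    intro hc
    apply hU
    have hc' : Uᶜ.card = q := by rw [Finset.card_compl, hc, Fintype.card_fin]; omega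
    -- This shuffle enumerates `U` and then its complement, each increasingly.
    refine ⟨finSumFinEquiv.symm.trans (finSumEquivOfFinset hc hc'), ?_, ?_⟩
    · simp only [Finset.coe_filter, Finset.mem_univ, true_and, Set.mem_ofPred_eq]
      constructor
      · intro a b hab
        simpa using hab
      · intro a b hab
        simpa using hab
    · ext x
      rw [← Finset.mem_coe (s := U), ← Finset.range_orderEmbOfFin U hc]
      simp
  · intro σ hσ
    rw [image_castAdd_compl, sign_shuffle (Finset.mem_filter.1 hσ).2, zsmul_eq_mul]

end TwoBlocks

end Grassmann

namespace Grassmann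

/-! ### Products of several monomials of even degree. -/

section ManyBlocks

variable {ι : Type*} [LinearOrder ι] {B : Type u} [CommRing B]

theorem sgn_biUnion {α : Type*} (s : Finset α) (S : α → Finset ι)
    (hd : Set.PairwiseDisjoint (s : Set α) S) (W : Finset ι) :
    sgn (s.biUnion S) W = ∏ j ∈ s, sgn (S j) W :=
  Finset.prod_biUnion hd

/-- Sorting a concatenation of disjoint sets inverts only pairs from different sets, so the sign is
a product over pairs of sets. The induction splits off the last factor. -/
theorem coe_prod_evenSingle {i : ℕ} (S : Fin i → Finset ι) (b : Fin i → B)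
    (hS : ∀ j, Even (S j).card) (hd : Pairwise (Function.onFun Disjoint S)) :
    ((∏ j, evenSingle (S j) (b j) : evenSubring ι B) : Grassmann ι B) =
      single (Finset.univ.biUnion S)
        (((∏ k, ∏ j, if j < k then sgn (S j) (S k) else 1 : ℤ) : B) * ∏ j, b j) := by
  induction i with
  | zero => ext T; simp [one_apply, single_apply]
  | succ i ih =>
    have hu : Finset.univ.biUnion S =
        (Finset.univ.biUnion fun j : Fin i => S j.castSucc) ∪ S (Fin.last i) := by
      ext x
      simp only [Finset.mem_biUnion, Finset.mem_univ, true_and, Finset.mem_union]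
      rw [Fin.exists_fin_succ']
    have hdis : Disjoint (Finset.univ.biUnion fun j : Fin i => S j.castSucc) (S (Fin.last i)) := by
      rw [Finset.disjoint_biUnion_left]
      exact fun j _ => hd (Fin.castSucc_lt_last j).ne
    have hd' : Pairwise (Function.onFun Disjoint fun j : Fin i => S j.castSucc) :=
      fun j k hjk => hd fun h => hjk (Fin.castSucc_injective i h)
    rw [Fin.prod_univ_castSucc]
    change ((∏ j : Fin i, evenSingle (S j.castSucc) (b j.castSucc) : evenSubring ι B) :
      Grassmann ι B) * (evenSingle (S (Fin.last i)) (b (Fin.last i)) : Grassmann ι B) = _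
    rw [ih (fun j => S j.castSucc) (fun j => b j.castSucc) (fun j => hS _) hd', evenSingle]
    simp only [hS, if_true]
    rw [single_mul_single, if_pos hdis, ← hu,
      sgn_biUnion _ _ (fun j _ k _ hjk => hd' hjk)]
    congr 1
    simp only [Fin.prod_univ_castSucc, Fin.castSucc_lt_castSucc_iff, Fin.castSucc_lt_last, if_true,
      lt_self_iff_false, if_false, (Fin.castSucc_lt_last _).not_gt, mul_one]
    push_cast
    ring

/-- Monomials with a common generator multiply to zero, so only partitions of `W` contribute to the
coefficient at `W` of a divided power. -/
theorem of_prod_evenSingle_apply_ne_zero (f : Grassmann ι B) (T : Finset (Finset ι)) {W : Finset ι}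
    (h : ((∏ S ∈ T, evenSingle S (f S) : evenSubring ι B) : Grassmann ι B) W ≠ 0) :
    (∀ S ∈ T, f S ≠ 0) ∧ Set.PairwiseDisjoint (T : Set (Finset ι)) id ∧ T.biUnion id = W := by
  induction T using Finset.induction_on generalizing W with
  | empty =>
    by_cases hW : W = ∅
    · simp [hW]
    · exact absurd (by simp [one_apply, hW]) h
  | insert S T hS ih =>
    rw [Finset.prod_insert hS] at h
    change ((evenSingle S (f S) : Grassmann ι B) *
      ((∏ S ∈ T, evenSingle S (f S) : evenSubring ι B) : Grassmann ι B)) W ≠ 0 at h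
    rw [mul_apply] at h
    obtain ⟨U, hU, hne⟩ := Finset.exists_ne_zero_of_sum_ne_zero h
    have h1 : (evenSingle S (f S) : Grassmann ι B) U ≠ 0 := fun h0 => hne (by rw [h0]; simp)
    obtain ⟨i1, i2, i3⟩ := ih (W := W \ U) fun h0 => hne (by rw [h0]; simp)
    have hUS : U = S := by
      by_contra hUS
      refine h1 ?_
      simp only [evenSingle]
      split_ifs <;> simp [single_apply, hUS]
    subst hUS
    have hf : f U ≠ 0 := by
      intro h0
      refine h1 ?_
      simp [evenSingle, h0]
    refine ⟨?_, ?_, ?_⟩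
    · intro S hS
      rcases Finset.mem_insert.1 hS with rfl | hS
      · exact hf
      · exact i1 S hS
    · rw [Finset.coe_insert]
      refine i2.insert fun V hV _ => ?_
      refine Finset.disjoint_of_subset_right ?_ (Finset.disjoint_sdiff (s := U) (t := W))
      rw [← i3]
      exact Finset.subset_biUnion_of_mem id hV
    · rw [Finset.biUnion_insert, i3, id, Finset.union_sdiff_of_subset (Finset.mem_powerset.1 hU)]

end ManyBlocks

/-! ### Partitions into blocks and cosets of shuffles. -/

section Blocks

open LargeTensor

variable {n i : ℕ} {B : Type u} [CommRing B]

/-- The image of the `j`-th block of length `n` under a permutation. -/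
def blockSet (σ : Equiv.Perm (Fin (n * i))) (j : Fin i) : Finset (Fin (n * i)) :=
  Finset.univ.image fun a : Fin n => σ (blockEquiv n i (j, a))

theorem injective_block (σ : Equiv.Perm (Fin (n * i))) (j : Fin i) :
    Function.Injective fun a : Fin n => σ (blockEquiv n i (j, a)) := fun a b h => by
  simpa using h

theorem card_blockSet (σ : Equiv.Perm (Fin (n * i))) (j : Fin i) : (blockSet σ j).card = n := by
  rw [blockSet, Finset.card_image_of_injective _ (injective_block σ j), Finset.card_univ,
    Fintype.card_fin]

theorem pairwise_disjoint_blockSet (σ : Equiv.Perm (Fin (n * i))) :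
    Pairwise (Function.onFun Disjoint (blockSet σ)) := by
  intro j k hjk
  rw [Function.onFun, Finset.disjoint_left]
  intro x hj hk
  obtain ⟨a, -, rfl⟩ := Finset.mem_image.1 hj
  obtain ⟨b, -, h⟩ := Finset.mem_image.1 hk
  simp only [EmbeddingLike.apply_eq_iff_eq, Prod.mk.injEq] at h
  exact hjk h.1.symm

theorem injective_blockSet (hn : 0 < n) (σ : Equiv.Perm (Fin (n * i))) :
    Function.Injective (blockSet σ) := by
  intro j k h
  by_contra hjk
  have := pairwise_disjoint_blockSet σ hjk
  rw [Function.onFun, h, disjoint_self] at this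
  have hc := card_blockSet σ k
  rw [this] at hc
  simp at hc
  omega

theorem biUnion_blockSet (σ : Equiv.Perm (Fin (n * i))) :
    Finset.univ.biUnion (blockSet σ) = Finset.univ := by
  ext x
  simp only [Finset.mem_biUnion, Finset.mem_univ, true_and, iff_true, blockSet, Finset.mem_image]
  refine ⟨((blockEquiv n i).symm (σ.symm x)).1, ((blockEquiv n i).symm (σ.symm x)).2, ?_⟩
  simp

theorem blockEquiv_lt_iff_of_ne {j k : Fin i} (hjk : j ≠ k) (a b : Fin n) :
    blockEquiv n i (j, a) < blockEquiv n i (k, b) ↔ j < k := by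
  have h : ∀ (j : Fin i) (a : Fin n), (blockEquiv n i (j, a) : ℕ) = a + n * j := fun j a => by
    simp [blockEquiv]
  have key : ∀ {j k : Fin i} (a b : Fin n), j < k →
      blockEquiv n i (j, a) < blockEquiv n i (k, b) := by
    intro j k a b hlt
    rw [Fin.lt_def, h, h]
    have h1 : n * ((j : ℕ) + 1) ≤ n * k := Nat.mul_le_mul_left n hlt
    have h2 := a.2
    rw [Nat.mul_add] at h1
    omega
  constructor
  · intro hlt
    by_contra hc
    exact hlt.not_gt (key b a (lt_of_le_of_ne (not_lt.1 hc) hjk.symm))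
  · exact key a b

theorem blockEquiv_lt_iff_of_eq (j : Fin i) (a b : Fin n) :
    blockEquiv n i (j, a) < blockEquiv n i (j, b) ↔ a < b := by
  rw [Fin.lt_def, Fin.lt_def]
  simp [blockEquiv]

/-- A shuffle increases within each block, so its inversions join different blocks. -/
theorem sign_of_mem_Sh {σ : Equiv.Perm (Fin (n * i))} (hσ : σ ∈ Sh n i) :
    (Equiv.Perm.sign σ : ℤ) =
      ∏ k, ∏ j, if j < k then sgn (blockSet σ j) (blockSet σ k) else 1 := by
  rw [sign_eq_prod_ite σ (fun x y => ((blockEquiv n i).symm x).1 < ((blockEquiv n i).symm y).1),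
    ← Equiv.prod_comp (blockEquiv n i), Fintype.prod_prod_type]
  · refine Finset.prod_congr rfl fun k _ => ?_
    have : ∀ b : Fin n, (∏ x, if ((blockEquiv n i).symm x).1 <
          ((blockEquiv n i).symm (blockEquiv n i (k, b))).1 then
        if σ (blockEquiv n i (k, b)) < σ x then (-1 : ℤ) else 1 else 1) =
        ∏ j, ∏ a, if j < k then
          if σ (blockEquiv n i (k, b)) < σ (blockEquiv n i (j, a)) then (-1 : ℤ) else 1 else 1 := by
      intro b
      rw [← Equiv.prod_comp (blockEquiv n i), Fintype.prod_prod_type]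
      simp
    rw [Finset.prod_congr rfl fun b _ => this b, Finset.prod_comm]
    refine Finset.prod_congr rfl fun j _ => ?_
    split_ifs with hjk
    · rw [blockSet, blockSet, sgn_image (injective_block σ j) (injective_block σ k),
        Finset.prod_comm]
    · simp
  · intro x y h
    obtain ⟨⟨j, a⟩, rfl⟩ := (blockEquiv n i).surjective x
    obtain ⟨⟨k, b⟩, rfl⟩ := (blockEquiv n i).surjective y
    rw [Equiv.symm_apply_apply, Equiv.symm_apply_apply] at h
    exact (blockEquiv_lt_iff_of_ne h.ne a b).2 h
  · intro x y hxy h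
    obtain ⟨⟨j, a⟩, rfl⟩ := (blockEquiv n i).surjective x
    obtain ⟨⟨k, b⟩, rfl⟩ := (blockEquiv n i).surjective y
    rw [Equiv.symm_apply_apply, Equiv.symm_apply_apply] at h
    by_cases hjk : j = k
    · subst hjk
      exact hσ j ((blockEquiv_lt_iff_of_eq j a b).1 hxy)
    · exact absurd ((blockEquiv_lt_iff_of_ne hjk a b).1 hxy) h

/-- Matching equal block images gives `ξ`, a permutation because nonempty blocks have distinct
images. Within a block, an increasing enumeration is determined by its image. -/
theorem exists_eq_mul_blockPerm (hn : 0 < n) {σ τ : Equiv.Perm (Fin (n * i))} (hσ : σ ∈ Sh n i)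
    (hτ : τ ∈ Sh n i) (h : Finset.univ.image (blockSet σ) = Finset.univ.image (blockSet τ)) :
    ∃ ξ : Equiv.Perm (Fin i), τ = σ * blockPerm n ξ := by
  have h1 : ∀ j, ∃ k, blockSet σ k = blockSet τ j := fun j => by
    have : blockSet τ j ∈ Finset.univ.image (blockSet σ) := by
      rw [h]; exact Finset.mem_image_of_mem _ (Finset.mem_univ j)
    simpa using this
  choose ξ hξ using h1
  have hinj : Function.Injective ξ := fun j k hjk =>
    injective_blockSet hn τ (by rw [← hξ j, ← hξ k, hjk])
  refine ⟨Equiv.ofBijective ξ (Finite.injective_iff_bijective.1 hinj), ?_⟩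
  ext x : 1
  obtain ⟨⟨j, a⟩, rfl⟩ := (blockEquiv n i).surjective x
  have h2 := congrFun (Finset.strictMono_ext (hσ (ξ j)) (hτ j) (hξ j)) a
  simpa [blockPerm, Equiv.permCongr_apply] using h2.symm

theorem exists_mem_Sh (T : Finset (Finset (Fin (n * i)))) (hT : T.card = i)
    (hc : ∀ S ∈ T, S.card = n) (hd : Set.PairwiseDisjoint (T : Set (Finset (Fin (n * i)))) id) :
    ∃ σ ∈ Sh n i, Finset.univ.image (blockSet σ) = T := by
  let e := T.equivFinOfCardEq hT
  have hcard : ∀ j, (e.symm j : Finset (Fin (n * i))).card = n := fun j => hc _ (e.symm j).2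
  -- The sets are numbered arbitrarily and each is enumerated increasingly. Disjointness gives
  -- injectivity, and counting then gives bijectivity.
  let g : Fin i × Fin n → Fin (n * i) := fun x =>
    (e.symm x.1 : Finset (Fin (n * i))).orderEmbOfFin (hcard x.1) x.2
  have hg : Function.Injective g := by
    rintro ⟨j, a⟩ ⟨k, b⟩ h
    have hj : g (j, a) ∈ (e.symm j : Finset (Fin (n * i))) := Finset.orderEmbOfFin_mem _ _ _
    have hk : g (k, b) ∈ (e.symm k : Finset (Fin (n * i))) := Finset.orderEmbOfFin_mem _ _ _
    have hjk : j = k := by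
      by_contra hne
      have hne' : (e.symm j : Finset (Fin (n * i))) ≠ e.symm k := fun h' =>
        hne (e.symm.injective (Subtype.ext h'))
      rw [h] at hj
      exact Finset.disjoint_left.1 (hd (e.symm j).2 (e.symm k).2 hne') hj hk
    subst hjk
    simpa [g] using h
  have hbij : Function.Bijective g :=
    (Fintype.bijective_iff_injective_and_card g).2 ⟨hg, by simp [mul_comm]⟩
  let σ : Equiv.Perm (Fin (n * i)) := (blockEquiv n i).symm.trans (Equiv.ofBijective g hbij)
  have hσ : ∀ j a, σ (blockEquiv n i (j, a)) = g (j, a) := fun j a => by simp [σ]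
  have hblock : ∀ j, blockSet σ j = e.symm j := by
    intro j
    ext x
    have h := Set.ext_iff.1 (Finset.range_orderEmbOfFin (e.symm j : Finset (Fin (n * i)))
      (hcard j)) x
    simp only [blockSet, Finset.mem_image, Finset.mem_univ, true_and, hσ, g]
    exact h
  refine ⟨σ, fun j => ?_, ?_⟩
  · intro a b hab
    simpa only [hσ, g] using
      ((e.symm j : Finset (Fin (n * i))).orderEmbOfFin (hcard j)).strictMono hab
  · ext S
    simp only [Finset.mem_image, Finset.mem_univ, true_and, hblock]
    constructor
    · rintro ⟨j, rfl⟩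
      exact (e.symm j).2
    · intro hS
      exact ⟨e ⟨S, hS⟩, by simp⟩

theorem image_blockSet_mul_blockPerm (σ : Equiv.Perm (Fin (n * i))) (ξ : Equiv.Perm (Fin i)) :
    Finset.univ.image (blockSet (σ * blockPerm n ξ)) = Finset.univ.image (blockSet σ) := by
  have : ∀ j, blockSet (σ * blockPerm n ξ) j = blockSet σ (ξ j) := fun j => by
    simp [blockSet, blockPerm, Equiv.permCongr_apply]
  ext S
  simp only [Finset.mem_image, Finset.mem_univ, true_and, this]
  exact (Equiv.exists_congr_left ξ).trans (by simp)

/-- The divided power as a sum over representatives of shuffles modulo permutations of the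
blocks. -/
theorem dpow_apply_univ_eq_sum_shuffles {f : Grassmann (Fin (n * i)) B} (hf : f.IsHomog n)
    (hn : Even n) (hn0 : 0 < n) {T : Finset (Equiv.Perm (Fin (n * i)))}
    (hT : IsRepSystem n i T) :
    dpow i f Finset.univ =
      ∑ σ ∈ T, (Equiv.Perm.sign σ : ℤ) • ∏ j, f (blockSet σ j) := by
  rw [dpow, AddSubmonoidClass.coe_finsetSum, sum_apply]
  symm
  -- A coset corresponds to the unordered family of block images. A family with nonzero contribution
  -- consists of disjoint `n`-element sets, hence comes from a shuffle and from its representative.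
  refine Finset.sum_of_injOn (fun σ => Finset.univ.image (blockSet σ)) ?_ ?_ ?_ ?_
  · intro σ hσ τ hτ h
    obtain ⟨ξ, hξ⟩ := exists_eq_mul_blockPerm hn0 (hT.1 σ hσ) (hT.1 τ hτ) h
    refine (hT.2 σ (hT.1 σ hσ)).unique ⟨hσ, 1, ?_⟩ ⟨hτ, ξ, hξ⟩
    ext x
    simp [blockPerm, Equiv.permCongr_apply]
  · intro σ _
    rw [Finset.mem_coe, Finset.mem_powersetCard]
    refine ⟨Finset.subset_univ _, ?_⟩
    rw [Finset.card_image_of_injective _ (injective_blockSet hn0 σ), Finset.card_univ,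
      Fintype.card_fin]
  · intro V hV hVT
    by_contra hne
    obtain ⟨h1, h2, h3⟩ := of_prod_evenSingle_apply_ne_zero f V hne
    obtain ⟨σ, hσ, rfl⟩ := exists_mem_Sh V (Finset.mem_powersetCard.1 hV).2
      (fun S hS => by by_contra hc; exact h1 S hS (hf S hc)) h2
    obtain ⟨τ, ⟨hτ, ξ, rfl⟩, -⟩ := hT.2 σ hσ
    exact hVT ⟨_, hτ, image_blockSet_mul_blockPerm σ ξ⟩
  · intro σ hσ
    rw [Finset.prod_image fun _ _ _ _ h => injective_blockSet hn0 σ h,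
      coe_prod_evenSingle (blockSet σ) (fun j => f (blockSet σ j))
        (fun j => by rwa [card_blockSet]) (pairwise_disjoint_blockSet σ), biUnion_blockSet,
      single_apply, if_pos rfl, ← sign_of_mem_Sh (hT.1 σ hσ), zsmul_eq_mul]

end Blocks

end Grassmann

/-! ### Algebra homomorphisms induced by morphisms of commutative monoids. -/

namespace SimplicialModule

variable {R : Type u} [CommRing R] {X Y : SimplicialObject (ModuleCat.{u} R)} (μ : X ⊗ X ⟶ X)
  (η : 𝟙_ (SimplicialObject (ModuleCat.{u} R)) ⟶ X)

/-- The morphism of algebras of `n`-simplices induced by a morphism of commutative monoids. -/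
def toSimplicialAlgHom (hc : (β_ X X).hom ≫ μ = μ)
    (ha : μ ▷ X ≫ μ = (α_ X X X).hom ≫ X ◁ μ ≫ μ) (ho : η ▷ X ≫ μ = (λ_ X).hom)
    (μ' : Y ⊗ Y ⟶ Y) (η' : 𝟙_ (SimplicialObject (ModuleCat.{u} R)) ⟶ Y)
    (hc' : (β_ Y Y).hom ≫ μ' = μ') (ha' : μ' ▷ Y ≫ μ' = (α_ Y Y Y).hom ≫ Y ◁ μ' ≫ μ')
    (ho' : η' ▷ Y ≫ μ' = (λ_ Y).hom) (f : X ⟶ Y) (hμ : μ ≫ f = (f ⊗ₘ f) ≫ μ')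
    (hη : η ≫ f = η') (n : ℕ) :
    (toSimplicialAlg μ η hc ha ho).obj n →ₐ[R] (toSimplicialAlg μ' η' hc' ha' ho').obj n :=
  have h1 : f.app (op ⦋n⦌) (η.app (op ⦋n⦌) (1 : R)) = η'.app (op ⦋n⦌) (1 : R) :=
    ConcreteCategory.congr_hom (NatTrans.congr_app hη (op ⦋n⦌)) (1 : R)
  { toFun := f.app (op ⦋n⦌)
    map_one' := h1
    map_mul' := app_mul_apply μ μ' f hμ
    map_zero' := map_zero (f.app (op ⦋n⦌)).hom
    map_add' := map_add (f.app (op ⦋n⦌)).hom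
    commutes' := fun r => (map_smul (f.app (op ⦋n⦌)).hom r (η.app (op ⦋n⦌) (1 : R))).trans
      (congrArg (r • ·) h1) }

end SimplicialModule

/-! ### Comparison with the shuffle formulas, and the functor to divided power chain algebras. -/

namespace LargeTensor

variable {R : Type u} [CommRing R]

theorem degen_eq {n m : ℕ} (f : Fin n → Fin m) (hf : Function.Injective f) :
    degen f = SimplexCategory.mkHom (SimplicialAlg.degenHom n (Finset.univ.image f)) := by
  refine congrArg SimplexCategory.mkHom (OrderHom.ext _ _ (funext fun x => Fin.ext ?_))
  rw [SimplicialAlg.degenHom_val (by simp [Finset.card_image_of_injective _ hf]),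
    Finset.filter_image, Finset.card_image_of_injective _ hf]
  rfl

theorem degHat_eq_comps (C : ComTilde R) {n m : ℕ} (f : Fin n → Fin m)
    (hf : Function.Injective f) (x : (Gam R).obj C _⦋n⦌) :
    degHat C f x = SimplicialAlg.comps (A := GamAlg C) x m (Finset.univ.image f) := by
  refine Eq.trans ?_ (SimplicialAlg.comps_apply (A := GamAlg C)
    (by simp [Finset.card_image_of_injective _ hf]) x).symm
  rw [degHat, degen_eq f hf]
  rfl

theorem incl_one (C : ComTilde R) : incl C 0 (normalizedChains C).one = oneHat C 0 :=
  (normalizedChains C).ι_one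

theorem incl_mul (C : ComTilde R) {p q : ℕ} (a : ((NGam R).obj C).X p)
    (b : ((NGam R).obj C).X q) :
    incl C (p + q) ((normalizedChains C).mul p q (p + q) a b) = shuffleProd C a b := by
  refine ((normalizedChains C).ι_mul a b).trans ?_
  rw [Grassmann.mul_apply_univ_eq_sum_shuffles ((normalizedChains C).isHomog_elt a _)]
  refine Finset.sum_congr rfl fun σ _ => ?_
  refine congrArg ((Equiv.Perm.sign σ : ℤ) • ·) (congrArg₂ (mulHat C) ?_ ?_)
  · exact (degHat_eq_comps C _ (σ.injective.comp (Fin.castAdd_injective p q)) _).symm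
  · exact (degHat_eq_comps C _ (σ.injective.comp (Fin.natAdd_injective q p)) _).symm

theorem prodHat_eq_prod (C : ComTilde R) {n i : ℕ} (x : Fin i → (Gam R).obj C _⦋n⦌) :
    prodHat C x = ∏ j, (show (GamAlg C).obj n from x j) :=
  List.prod_ofFn (M := (GamAlg C).obj n) (f := x)

theorem incl_divPow (C : ComTilde R) (i : ℕ) {n : ℕ} (hn0 : 0 < n) (hn : Even n)
    {T : Finset (Equiv.Perm (Fin (n * i)))} (hT : IsRepSystem n i T)
    (c : ((NGam R).obj C).X n) :
    incl C (n * i) ((normalizedChains C).divPow i hn0 c) = shuffleCosetSum C i T c := by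
  refine ((normalizedChains C).ι_divPow i hn0 c).trans ?_
  rw [SimplicialAlg.gamma, Grassmann.divPow_of_even hn,
    Grassmann.dpow_apply_univ_eq_sum_shuffles (SimplicialAlg.isHomog_comps _ _) hn hn0 hT]
  refine Finset.sum_congr rfl fun σ _ => ?_
  rw [prodHat_eq_prod]
  refine congrArg ((Equiv.Perm.sign σ : ℤ) • ·) (Finset.prod_congr rfl fun j _ => ?_)
  exact (degHat_eq_comps C _ (Grassmann.injective_block σ j) _).symm

/-- The morphism of algebras of `n`-simplices induced by a morphism of commutative monoids. -/
noncomputable def GamAlgHom {C C' : ComTilde R} (f : C ⟶ C') (n : ℕ) :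
    (GamAlg C).obj n →ₐ[R] (GamAlg C').obj n :=
  SimplicialModule.toSimplicialAlgHom _ _ _ _ _ _ _ _ _ _ ((Gam R).map f)
    (muHat_naturality f) (etaHat_naturality f) n

theorem GamAlgHom_map {C C' : ComTilde R} (f : C ⟶ C') {m n : ℕ}
    (θ : Fin (m + 1) →o Fin (n + 1)) (x : (GamAlg C).obj n) :
    GamAlgHom f m ((GamAlg C).map θ x) = (GamAlg C').map θ (GamAlgHom f n x) :=
  ConcreteCategory.congr_hom (((Gam R).map f).naturality (SimplexCategory.mkHom θ).op) x

/-- The functor from commutative monoids for the large tensor product to divided power chain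
algebras. -/
noncomputable def toDPChainAlg : ComTilde R ⥤ DPChainAlg R where
  obj C := ⟨(NGam R).obj C, (normalizedChains C).dpChainAlgStruct⟩
  map {C C'} f := SimplicialAlg.NormalizedChains.dpChainAlgHom (N := normalizedChains C)
    (N' := normalizedChains C') ((NGam R).map f) (GamAlgHom f) (GamAlgHom_map f)
    fun x => SimplicialModule.normalizedArrow_map ((Gam R).map f) x
  map_id C := DPChainAlg.Hom.ext ((NGam R).map_id C)
  map_comp f g := DPChainAlg.Hom.ext ((NGam R).map_comp f g)

end LargeTensor

theorem mainTheorem1 (R : Type u) [CommRing R] :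
    ∃ (S : ∀ C : LargeTensor.ComTilde R,
        LargeTensor.DPChainAlgStruct R ((LargeTensor.NGam R).obj C))
      (F : LargeTensor.ComTilde R ⥤ LargeTensor.DPChainAlg R),
      (∀ C, F.obj C = ⟨(LargeTensor.NGam R).obj C, S C⟩) ∧
      F ⋙ LargeTensor.DPChainAlg.forget = LargeTensor.NGam R ∧
      (∀ C, LargeTensor.incl C 0 (S C).one = LargeTensor.oneHat C 0) ∧
      (∀ (C) {p q : ℕ} (a : ((LargeTensor.NGam R).obj C).X p)
        (b : ((LargeTensor.NGam R).obj C).X q),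
        LargeTensor.incl C (p + q) ((S C).mul rfl a b) = LargeTensor.shuffleProd C a b) ∧
      (∀ (C) (i : ℕ) {n : ℕ} (hn : 0 < n), Even n →
        ∀ T : Finset (Equiv.Perm (Fin (n * i))), LargeTensor.IsRepSystem n i T →
        ∀ c : ((LargeTensor.NGam R).obj C).X n,
          LargeTensor.incl C (n * i) ((S C).gamma i hn c) =
            LargeTensor.shuffleCosetSum C i T c) :=
  ⟨fun C => (LargeTensor.normalizedChains C).dpChainAlgStruct, LargeTensor.toDPChainAlg,
    fun _ => rfl, rfl, LargeTensor.incl_one, LargeTensor.incl_mul,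
    fun C i _ hn0 hn _ hT c => LargeTensor.incl_divPow C i hn0 hn hT c⟩
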